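/- Let $k$ be a commutative ring and let $\mathcal{A}$, $\mathcal{B}$ be $k$-linear categories, where every hom space of $\mathcal{A}$ is a projective $k$-module. Let $\mathrm{Ch}^b(\mathcal{B})$ be the dg category of bounded cochain complexes over $\mathcal{B}$, with hom complexes $\underline{\mathrm{Hom}}(K,L)$, $\underline{\mathrm{Hom}}^n(K,L)=\prod_i \mathrm{Hom}(K^i,L^{i+n})$, $d(f)=\delta_L f-(-1)^{n}f\delta_K$, and let $K^b(\mathcal{B})=H^0(\mathrm{Ch}^b(\mathcal{B}))$ be its homotopy category. Let $F,G\colon\mathcal{A}\to\mathrm{Ch}^b(\mathcal{B})$ be dg functors (that is, $k$-linear functors to bounded complexes and chain maps) such that the pair $(F,G)$ is unobstructed: $$H^n\big(\underline{\mathrm{Hom}}(F(X'),G(X))\big)=0\quad\text{for all } n<0 \text{ and all objects } X,X'\in\mathcal{A}.$$ Let $H^0(F),H^0(G)\colon\mathcal{A}\to K^b(\mathcal{B})$ be the induced functors. Let $\mathrm{Bar}(\mathcal{A})$ be the two-sided bar complex of $\mathcal{A}$: the complex of $(\mathcal{A},\mathcal{A})$-bimodules whose term in degree $-r$ ($r\ge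 0$) is $$\mathrm{Bar}^{-r}(X,X')=\bigoplus_{X_0,\dots,X_r\in\mathcal{A}}\mathrm{Hom}(X_0,X)\otimes_k\mathrm{Hom}(X_1,X_0)\otimes_k\cdots\otimes_k\mathrm{Hom}(X',X_r),$$ with differential $[f_0,\dots,f_{r+1}]\mapsto\sum_{i=0}^r(-1)^i[f_0,\dots,f_i\circ f_{i+1},\dots,f_{r+1}]$ for $r\ge 1$ (and zero for $r=0$), and with action $g\cdot[f_0,\dots,f_{r+1}]\cdot g'=[g\circ f_0,f_1,\dots,f_r,f_{r+1}\circ g']$. Let $M^G_F$ be the dg bimodule $M^G_F(X,X')=\underline{\mathrm{Hom}}(F(X'),G(X))$ with action $a\cdot m\cdot b=G(a)\circ m\circ F(b)$. A degree $l$ bimodule map $\tau$ is a family of degree $l$ $k$-linear maps commuting with the actions, its differential is $d\tau=d\circ\tau-(-1)^l\tau\circ d$, it is closed if $d\tau=0$, and two such maps are homotopic if their difference is the differential of a bimodule map of degree $l-1$. An $A_\infty$-natural transformation from $F$ to $G$ is a closed degree $0$ bimodule map $\tau\colon\mathrm{Bar}(\mathcal{A})\to M^G_F$; it extends a natural transformation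 $\eta\colon H^0(F)\to H^0(G)$ if for every object $X$ of $\mathcal{A}$ the chain map $\tau([\mathrm{id}_X,\mathrm{id}_X])\colon F(X)\to G(X)$ represents $\eta_X$. Then every natural transformation $\eta\colon H^0(F)\to H^0(G)$ extends to an $A_\infty$-natural transformation $\mathrm{Bar}(\mathcal{A})\to M^G_F$, and any two $A_\infty$-natural transformations extending $\eta$ are homotopic. -/

import Mathlib

open CategoryTheory CochainComplex CochainComplex.HomComplex
open scoped TensorProduct DirectSum

universe w u v u' v' x y

/-! ### Bounded complexes and the bounded homotopy category -/

/-- A cochain complex is bounded if its terms vanish outside a finite range of degrees. -/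
def IsBoundedComplex (B : Type u') [Category.{v'} B] [Preadditive B] :
    ObjectProperty (CochainComplex B ℤ) :=
  fun K => ∃ a b : ℤ, ∀ i : ℤ, (i < a ∨ b < i) → Limits.IsZero (K.X i)

/-- `Z⁰(Ch^b(B))`: bounded complexes over `B` and chain maps. The hom complexes of the dg category
`Ch^b(B)` are given, degree by degree, by Mathlib's `HomComplex.Cochain K L n`, with the
differential `f ↦ δ_L ∘ f - (-1)^n f ∘ δ_K`. For a `k`-linear category `A` (a dg category with
trivial grading and differential), a dg functor `A → Ch^b(B)` is the same thing as a `k`-linear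
functor `A ⥤ Chb B`. -/
abbrev Chb (B : Type u') [Category.{v'} B] [Preadditive B] :=
  (IsBoundedComplex B).FullSubcategory

/-- `K^b(B) = H⁰(Ch^b(B))`: bounded complexes over `B` and homotopy classes of chain maps. -/
abbrev Kb (B : Type u') [Category.{v'} B] [Preadditive B] :=
  InducedCategory (HomotopyCategory B (ComplexShape.up ℤ))
    (fun K : Chb B => (HomotopyCategory.quotient B (ComplexShape.up ℤ)).obj K.obj)

/-- The canonical functor `Z⁰(Ch^b(B)) ⥤ H⁰(Ch^b(B))`. -/
def Kb.quotient (B : Type u') [Category.{v'} B] [Preadditive B] : Chb B ⥤ Kb B where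
  obj K := K
  map φ := InducedCategory.homMk ((HomotopyCategory.quotient B (ComplexShape.up ℤ)).map φ.hom)

/-- The functor `H⁰(F) : A ⥤ K^b(B)` induced by `F : A → Ch^b(B)`. -/
abbrev H0 {A : Type u} [Category.{v} A] {B : Type u'} [Category.{v'} B] [Preadditive B]
    (F : A ⥤ Chb B) : A ⥤ Kb B :=
  F ⋙ Kb.quotient B

/-- The pair `(F, G)` is unobstructed: `H^n(Hom(F X', G X)) = 0` for all `n < 0` and all
objects `X`, `X'`. -/
def Unobstructed {A : Type u} [Category.{v} A] {B : Type u'} [Category.{v'} B] [Preadditive B]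
    (F G : A ⥤ Chb B) : Prop :=
  ∀ (X X' : A) (n : ℤ), n < 0 → Subsingleton (CohomologyClass (F.obj X').obj (G.obj X).obj n)

/-! ### Bimodules over a `k`-linear category, valued in complexes of `k`-modules -/

/-- An `(A, A)`-bimodule over a `k`-linear category `A`, regarded as a dg category with trivial
grading and zero differential: a family of complexes of `k`-modules `B(X, X')` with action maps
`Hom(Y ← X) ⊗ B(X, X') ⊗ Hom(X' ← Y') → B(Y, Y')`, `f ⊗ b ⊗ g ↦ f · b · g = act f g b`. -/
structure DGBimodule (k : Type w) [CommRing k] (A : Type u) [Category.{v} A] [Preadditive A]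
    [Linear k A] where
  obj : A → A → ℤ → Type x
  [addCommGroup : ∀ X X' n, AddCommGroup (obj X X' n)]
  [module : ∀ X X' n, Module k (obj X X' n)]
  d : ∀ {X X' : A} (n m : ℤ), n + 1 = m → (obj X X' n →ₗ[k] obj X X' m)
  d_d : ∀ {X X' : A} (n m p : ℤ) (h : n + 1 = m) (h' : m + 1 = p) (b : obj X X' n),
    d m p h' (d n m h b) = 0
  act : ∀ {X X' Y Y' : A}, (X ⟶ Y) → (Y' ⟶ X') → ∀ n : ℤ, obj X X' n →ₗ[k] obj Y Y' n
  act_add_left : ∀ {X X' Y Y' : A} (f₁ f₂ : X ⟶ Y) (g : Y' ⟶ X') (n : ℤ) (b : obj X X' n),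
    act (f₁ + f₂) g n b = act f₁ g n b + act f₂ g n b
  act_smul_left : ∀ {X X' Y Y' : A} (c : k) (f : X ⟶ Y) (g : Y' ⟶ X') (n : ℤ) (b : obj X X' n),
    act (c • f) g n b = c • act f g n b
  act_add_right : ∀ {X X' Y Y' : A} (f : X ⟶ Y) (g₁ g₂ : Y' ⟶ X') (n : ℤ) (b : obj X X' n),
    act f (g₁ + g₂) n b = act f g₁ n b + act f g₂ n b
  act_smul_right : ∀ {X X' Y Y' : A} (c : k) (f : X ⟶ Y) (g : Y' ⟶ X') (n : ℤ) (b : obj X X' n),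
    act f (c • g) n b = c • act f g n b
  act_id : ∀ {X X' : A} (n : ℤ) (b : obj X X' n), act (𝟙 X) (𝟙 X') n b = b
  act_act : ∀ {X X' Y Y' Z Z' : A} (f : X ⟶ Y) (f' : Y ⟶ Z) (g : Y' ⟶ X') (g' : Z' ⟶ Y') (n : ℤ)
    (b : obj X X' n), act (f ≫ f') (g' ≫ g) n b = act f' g' n (act f g n b)
  d_act : ∀ {X X' Y Y' : A} (f : X ⟶ Y) (g : Y' ⟶ X') (n m : ℤ) (h : n + 1 = m) (b : obj X X' n),
    d n m h (act f g n b) = act f g m (d n m h b)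

attribute [instance] DGBimodule.addCommGroup DGBimodule.module

section BimoduleMaps

variable {k : Type w} [CommRing k] {A : Type u} [Category.{v} A] [Preadditive A] [Linear k A]

/-- The `k`-module of degree `l` bimodule maps `M → N`: families of degree `l` linear maps
`M(X, X') → N(X, X')`, not necessarily compatible with the differentials, such that
`τ (f · b · g) = f · τ b · g` (the Koszul sign is trivial, as `f` has degree zero). The component
from degree `T.p` to degree `T.q = T.p + l` is indexed by a `Triplet`. -/
def BimoduleHom (M : DGBimodule.{w, u, v, x} k A) (N : DGBimodule.{w, u, v, y} k A) (l : ℤ) :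
    Submodule k (∀ (X X' : A) (T : Triplet l), M.obj X X' T.p →ₗ[k] N.obj X X' T.q) where
  carrier := {τ | ∀ (X X' Y Y' : A) (f : X ⟶ Y) (g : Y' ⟶ X') (T : Triplet l) (b : M.obj X X' T.p),
    τ Y Y' T (M.act f g T.p b) = N.act f g T.q (τ X X' T b)}
  add_mem' := by
    intro τ τ' h h' X X' Y Y' f g T b
    simp [h X X' Y Y' f g T b, h' X X' Y Y' f g T b]
  zero_mem' := by
    intro X X' Y Y' f g T b
    simp
  smul_mem' := by
    intro c τ h X X' Y Y' f g T b
    simp [h X X' Y Y' f g T b]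

namespace BimoduleHom

variable {M : DGBimodule.{w, u, v, x} k A} {N : DGBimodule.{w, u, v, y} k A}

/-- The component of a degree `l` bimodule map from degree `p` to degree `q = p + l`. -/
def app {l : ℤ} (τ : BimoduleHom M N l) (X X' : A) (p q : ℤ) (h : p + l = q) :
    M.obj X X' p →ₗ[k] N.obj X X' q :=
  τ.1 X X' ⟨p, q, h⟩

lemma app_act {l : ℤ} (τ : BimoduleHom M N l) {X X' Y Y' : A} (f : X ⟶ Y) (g : Y' ⟶ X')
    (p q : ℤ) (h : p + l = q) (b : M.obj X X' p) :
    app τ Y Y' p q h (M.act f g p b) = N.act f g q (app τ X X' p q h b) :=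
  τ.2 X X' Y Y' f g ⟨p, q, h⟩ b

/-- The differential `d τ = d_N ∘ τ - (-1)^l τ ∘ d_M` of a degree `l` bimodule map. -/
def diff (l m : ℤ) (h : l + 1 = m) (τ : BimoduleHom M N l) : BimoduleHom M N m :=
  ⟨fun X X' T =>
      (N.d (T.p + l) T.q (by have := T.hpq; lia)).comp (app τ X X' T.p (T.p + l) rfl) -
        l.negOnePow • (app τ X X' (T.p + 1) T.q (by have := T.hpq; lia)).comp
          (M.d T.p (T.p + 1) rfl), by
    intro X X' Y Y' f g T b
    simp [app_act, DGBimodule.d_act, Units.smul_def]⟩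

/-- A bimodule map is closed if its differential vanishes. -/
def IsClosed {l : ℤ} (τ : BimoduleHom M N l) : Prop :=
  diff l (l + 1) rfl τ = 0

/-- Degree `l` bimodule maps are homotopic if they differ by the differential of a bimodule map of
degree `l - 1`. -/
def Homotopic {l : ℤ} (τ τ' : BimoduleHom M N l) : Prop :=
  ∃ h : BimoduleHom M N (l - 1), τ - τ' = diff (l - 1) l (by lia) h

end BimoduleHom

end BimoduleMaps

/-! ### The bar complex of a `k`-linear category -/

/-- `r`-tuples of objects. -/
inductive ObjTuple (A : Type u) : ℕ → Type u
  | nil : ObjTuple A 0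
  | cons {r : ℕ} (Y : A) (t : ObjTuple A r) : ObjTuple A (r + 1)

section Bar

variable (k : Type w) [CommRing k] {A : Type u} [Category.{v} A] [Preadditive A] [Linear k A]

/-- For a tuple `t = (X₀, …, X_r)`, the tensor product over `k`
`Hom(X ← X₀) ⊗ (Hom(X₀ ← X₁) ⊗ (⋯ ⊗ Hom(X_r ← X')))`; for the empty tuple this is
`Hom(X ← X')`. -/
def BarTensor (X' : A) : {r : ℕ} → A → ObjTuple A r → ModuleCat.{v} k
  | _, X, .nil => ModuleCat.of k (X' ⟶ X)
  | _, X, .cons Y t => ModuleCat.of k ((Y ⟶ X) ⊗[k] BarTensor X' Y t)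

namespace BarTensor

variable {k}

/-- The elements of the tensor product for the empty tuple. -/
def single {X X' : A} : (X' ⟶ X) ≃ₗ[k] BarTensor k X' X .nil :=
  LinearEquiv.refl k (X' ⟶ X)

/-- The tensor product for `(Y, t)` is `Hom(X ← Y)` tensored with the one for `t`. -/
def consEquiv {X X' Y : A} {r : ℕ} {t : ObjTuple A r} :
    (Y ⟶ X) ⊗[k] BarTensor k X' Y t ≃ₗ[k] BarTensor k X' X (.cons Y t) :=
  LinearEquiv.refl k ((Y ⟶ X) ⊗[k] BarTensor k X' Y t)

/-- `[f, f₀, f₁, …]` from `f` and `[f₀, f₁, …]`. -/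
def cons {X X' Y : A} {r : ℕ} {t : ObjTuple A r} :
    (Y ⟶ X) →ₗ[k] BarTensor k X' Y t →ₗ[k] BarTensor k X' X (.cons Y t) :=
  (TensorProduct.mk k (Y ⟶ X) (BarTensor k X' Y t)).compr₂ consEquiv.toLinearMap

/-- The linear map on the tensor product for `(Y, t)` induced by a bilinear map. -/
def lift {X X' Y : A} {r : ℕ} {t : ObjTuple A r} {P : Type x} [AddCommGroup P] [Module k P]
    (φ : (Y ⟶ X) →ₗ[k] BarTensor k X' Y t →ₗ[k] P) :
    BarTensor k X' X (.cons Y t) →ₗ[k] P :=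
  (TensorProduct.lift φ).comp consEquiv.symm.toLinearMap

@[simp]
lemma lift_cons {X X' Y : A} {r : ℕ} {t : ObjTuple A r} {P : Type x} [AddCommGroup P]
    [Module k P] (φ : (Y ⟶ X) →ₗ[k] BarTensor k X' Y t →ₗ[k] P) (f : Y ⟶ X)
    (b : BarTensor k X' Y t) : lift φ (cons f b) = φ f b :=
  TensorProduct.lift.tmul f b

lemma hom_ext_single {X X' : A} {P : Type x} [AddCommGroup P] [Module k P]
    {φ ψ : BarTensor k X' X .nil →ₗ[k] P} (h : ∀ f : X' ⟶ X, φ (single f) = ψ (single f)) :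
    φ = ψ :=
  LinearMap.ext h

lemma hom_ext {X X' Y : A} {r : ℕ} {t : ObjTuple A r} {P : Type x} [AddCommGroup P] [Module k P]
    {φ ψ : BarTensor k X' X (.cons Y t) →ₗ[k] P}
    (h : ∀ (f : Y ⟶ X) (b : BarTensor k X' Y t), φ (cons f b) = ψ (cons f b)) : φ = ψ :=
  TensorProduct.ext' (g := φ) (h := ψ) h

/-- The left action `[f₀, f₁, …] ↦ [f ∘ f₀, f₁, …]`. -/
def lact {X' : A} : {r : ℕ} → {X Y : A} → (t : ObjTuple A r) → (X ⟶ Y) →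
    (BarTensor k X' X t →ₗ[k] BarTensor k X' Y t)
  | _, _, _, .nil, f => (single.toLinearMap.comp (Linear.rightComp k X' f)).comp
      single.symm.toLinearMap
  | _, _, _, .cons Z _, f => lift (cons.comp (Linear.rightComp k Z f))

/-- The right action `[…, f_r, f_{r+1}] ↦ […, f_r, f_{r+1} ∘ g]`. -/
def ract {X' Y' : A} (g : Y' ⟶ X') : {r : ℕ} → {X : A} → (t : ObjTuple A r) →
    (BarTensor k X' X t →ₗ[k] BarTensor k Y' X t)
  | _, X, .nil => (single.toLinearMap.comp (Linear.leftComp k X g)).comp single.symm.toLinearMap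
  | _, _, .cons _ t => lift (cons.compl₂ (ract g t))

@[simp]
lemma lact_single {X X' Y : A} (f : X ⟶ Y) (g : X' ⟶ X) :
    lact (k := k) .nil f (single g) = single (g ≫ f) := rfl

@[simp]
lemma lact_cons {X X' Y Z : A} {r : ℕ} {t : ObjTuple A r} (f : X ⟶ Y) (g : Z ⟶ X)
    (b : BarTensor k X' Z t) : lact (.cons Z t) f (cons g b) = cons (g ≫ f) b := by
  simp [lact]

@[simp]
lemma ract_single {X X' Y' : A} (g : Y' ⟶ X') (f : X' ⟶ X) :
    ract (k := k) g .nil (single f) = single (g ≫ f) := rfl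

@[simp]
lemma ract_cons {X X' Y' Z : A} {r : ℕ} {t : ObjTuple A r} (g : Y' ⟶ X') (f : Z ⟶ X)
    (b : BarTensor k X' Z t) : ract g (.cons Z t) (cons f b) = cons f (ract g t b) := by
  simp [ract]

lemma lact_add {X' X Y : A} {r : ℕ} (t : ObjTuple A r) (f f' : X ⟶ Y) :
    lact (k := k) (X' := X') t (f + f') = lact t f + lact t f' := by
  cases t with
  | nil => exact hom_ext_single fun g => by simp
  | cons Z t => exact hom_ext fun g b => by simp

lemma lact_smul {X' X Y : A} {r : ℕ} (t : ObjTuple A r) (c : k) (f : X ⟶ Y) :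
    lact (k := k) (X' := X') t (c • f) = c • lact t f := by
  cases t with
  | nil => exact hom_ext_single fun g => by simp
  | cons Z t => exact hom_ext fun g b => by simp

lemma lact_id {X' X : A} {r : ℕ} (t : ObjTuple A r) :
    lact (k := k) (X' := X') t (𝟙 X) = LinearMap.id := by
  cases t with
  | nil => exact hom_ext_single fun g => by simp
  | cons Z t => exact hom_ext fun g b => by simp

lemma lact_comp {X' X Y Z : A} {r : ℕ} (t : ObjTuple A r) (f : X ⟶ Y) (f' : Y ⟶ Z) :
    lact (k := k) (X' := X') t (f ≫ f') = (lact t f').comp (lact t f) := by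
  cases t with
  | nil => exact hom_ext_single fun g => by simp
  | cons Z t => exact hom_ext fun g b => by simp

lemma ract_add {X' Y' X : A} {r : ℕ} (t : ObjTuple A r) (g g' : Y' ⟶ X') :
    ract (k := k) (X := X) (g + g') t = ract g t + ract g' t := by
  induction t generalizing X with
  | nil => exact hom_ext_single fun g => by simp
  | cons Z t ih => exact hom_ext fun g b => by simp [ih]

lemma ract_smul {X' Y' X : A} {r : ℕ} (t : ObjTuple A r) (c : k) (g : Y' ⟶ X') :
    ract (k := k) (X := X) (c • g) t = c • ract g t := by
  induction t generalizing X with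
  | nil => exact hom_ext_single fun g => by simp
  | cons Z t ih => exact hom_ext fun g b => by simp [ih]

lemma ract_id {X' X : A} {r : ℕ} (t : ObjTuple A r) :
    ract (k := k) (X := X) (𝟙 X') t = LinearMap.id := by
  induction t generalizing X with
  | nil => exact hom_ext_single fun g => by simp
  | cons Z t ih => exact hom_ext fun g b => by simp [ih]

lemma ract_comp {X' Y' Z' X : A} {r : ℕ} (t : ObjTuple A r) (g : Y' ⟶ X') (g' : Z' ⟶ Y') :
    ract (k := k) (X := X) (g' ≫ g) t = (ract g' t).comp (ract g t) := by
  induction t generalizing X with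
  | nil => exact hom_ext_single fun g => by simp
  | cons Z t ih => exact hom_ext fun g b => by simp [ih]

lemma lact_ract {X X' Y Y' : A} {r : ℕ} (t : ObjTuple A r) (f : X ⟶ Y) (g : Y' ⟶ X')
    (b : BarTensor k X' X t) : lact t f (ract g t b) = ract g t (lact t f b) := by
  suffices h : (lact t f).comp (ract (k := k) g t) = (ract g t).comp (lact t f) from
    LinearMap.congr_fun h b
  cases t with
  | nil => exact hom_ext_single fun g => by simp
  | cons Z t => exact hom_ext fun g b => by simp

end BarTensor

/-- `Bar^{1-r}(X, X')`: the direct sum over all tuples `(X₀, …, X_{r-1})` of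
`Hom(X ← X₀) ⊗ Hom(X₀ ← X₁) ⊗ ⋯ ⊗ Hom(X_{r-1} ← X')`. -/
abbrev BarSum (X X' : A) (r : ℕ) : Type (max u v) :=
  ⨁ t : ObjTuple A r, BarTensor k X' X t

namespace BarSum

variable {k}

open scoped Classical in
/-- The inclusion of a summand. -/
noncomputable def incl {X X' : A} {r : ℕ} (t : ObjTuple A r) :
    BarTensor k X' X t →ₗ[k] BarSum k X X' r :=
  DirectSum.lof k (ObjTuple A r) (fun t => BarTensor k X' X t) t

open scoped Classical in
/-- The linear map on the direct sum induced by linear maps on the summands. -/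
noncomputable def desc {X X' : A} {r : ℕ} {P : Type x} [AddCommGroup P] [Module k P]
    (φ : ∀ t : ObjTuple A r, BarTensor k X' X t →ₗ[k] P) : BarSum k X X' r →ₗ[k] P :=
  DirectSum.toModule k (ObjTuple A r) P φ

@[simp]
lemma desc_incl {X X' : A} {r : ℕ} {P : Type x} [AddCommGroup P] [Module k P]
    (φ : ∀ t : ObjTuple A r, BarTensor k X' X t →ₗ[k] P) (t : ObjTuple A r)
    (b : BarTensor k X' X t) : desc φ (incl t b) = φ t b := by
  classical
  exact DirectSum.toModule_lof (φ := φ) k t b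

lemma hom_ext {X X' : A} {r : ℕ} {P : Type x} [AddCommGroup P] [Module k P]
    {φ ψ : BarSum k X X' r →ₗ[k] P}
    (h : ∀ (t : ObjTuple A r) (b : BarTensor k X' X t), φ (incl t b) = ψ (incl t b)) : φ = ψ := by
  classical
  exact DirectSum.linearMap_ext k fun t => LinearMap.ext (h t)

/-- `[f₀, …, f_r] ↦ [f, f₀, …, f_r]` on direct sums. -/
noncomputable def cons {X X' Y : A} {r : ℕ} :
    (Y ⟶ X) →ₗ[k] BarSum k Y X' r →ₗ[k] BarSum k X X' (r + 1) :=
  LinearMap.flip (desc fun t => BarTensor.cons.flip.compr₂ (incl (.cons Y t)))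

@[simp]
lemma cons_incl {X X' Y : A} {r : ℕ} (f : Y ⟶ X) (t : ObjTuple A r) (b : BarTensor k X' Y t) :
    cons f (incl t b) = incl (.cons Y t) (BarTensor.cons f b) := by
  simp [cons]

/-- The action `[f₀, …, f_r] ↦ [f ∘ f₀, …, f_r ∘ g]` on direct sums. -/
noncomputable def act {X X' Y Y' : A} (f : X ⟶ Y) (g : Y' ⟶ X') (r : ℕ) :
    BarSum k X X' r →ₗ[k] BarSum k Y Y' r :=
  desc fun t => (incl t).comp ((BarTensor.lact t f).comp (BarTensor.ract g t))

@[simp]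
lemma act_incl {X X' Y Y' : A} (f : X ⟶ Y) (g : Y' ⟶ X') {r : ℕ} (t : ObjTuple A r)
    (b : BarTensor k X' X t) :
    act f g r (incl t b) = incl t (BarTensor.lact t f (BarTensor.ract g t b)) := by
  simp [act]

/-- Composing the first two entries,
`f ⊗ [f₀, f₁, …] ↦ [f ∘ f₀, f₁, …]`, as a bilinear map. -/
noncomputable def merge {X X' Y : A} {r : ℕ} (t : ObjTuple A r) :
    (Y ⟶ X) →ₗ[k] BarTensor k X' Y t →ₗ[k] BarSum k X X' r :=
  LinearMap.mk₂ k (fun f b => incl t (BarTensor.lact t f b))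
    (by intro f f' b; simp [BarTensor.lact_add])
    (by intro c f b; simp [BarTensor.lact_smul])
    (by intro f b b'; simp)
    (by intro c f b; simp)

@[simp]
lemma merge_apply {X X' Y : A} {r : ℕ} (t : ObjTuple A r) (f : Y ⟶ X)
    (b : BarTensor k X' Y t) : merge t f b = incl t (BarTensor.lact t f b) := rfl

/-- The bar differential `[f₀, …, f_{r+1}] ↦ ∑_{0 ≤ i ≤ r} (-1)^i [f₀, …, f_i ∘ f_{i+1}, …, f_{r+1}]`
on a summand, by recursion on the tuple: writing an element as `[f₀, b]` with
`b = [f₁, …, f_{r+1}]`, the term with `i = 0` is `[f₀ ∘ f₁, f₂, …]` and the sum of the other terms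
is `-[f₀, α b]`. -/
noncomputable def alphaAux {X' : A} : {r : ℕ} → {X : A} → (t : ObjTuple A (r + 1)) →
    (BarTensor k X' X t →ₗ[k] BarSum k X X' r)
  | 0, _, .cons _ t => BarTensor.lift (merge t)
  | _ + 1, _, .cons _ t => BarTensor.lift (merge t - cons.compl₂ (alphaAux t))

/-- The bar differential `α : Bar^{-r}(X, X') → Bar^{1-r}(X, X')`,
`[f₀, …, f_{r+1}] ↦ ∑_{0 ≤ i ≤ r} (-1)^i [f₀, …, f_i ∘ f_{i+1}, …, f_{r+1}]`. -/
noncomputable def alpha (X X' : A) (r : ℕ) : BarSum k X X' (r + 1) →ₗ[k] BarSum k X X' r :=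
  desc alphaAux

lemma alpha_zero {X X' Y : A} (f : Y ⟶ X) (b : BarSum k Y X' 0) :
    alpha X X' 0 (cons f b) = act f (𝟙 X') 0 b := by
  suffices h : (alpha X X' 0).comp (cons f) = act (k := k) f (𝟙 X') 0 from LinearMap.congr_fun h b
  exact hom_ext fun t b => by simp [alpha, alphaAux, BarTensor.ract_id]

lemma alpha_succ {X X' Y : A} {r : ℕ} (f : Y ⟶ X) (b : BarSum k Y X' (r + 1)) :
    alpha X X' (r + 1) (cons f b) = act f (𝟙 X') (r + 1) b - cons f (alpha Y X' r b) := by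
  suffices h : (alpha X X' (r + 1)).comp (cons f) =
      act (k := k) f (𝟙 X') (r + 1) - (cons f).comp (alpha Y X' r) from LinearMap.congr_fun h b
  exact hom_ext fun t b => by simp [alpha, alphaAux, BarTensor.ract_id]

lemma hom_ext_cons {X X' : A} {r : ℕ} {P : Type x} [AddCommGroup P] [Module k P]
    {φ ψ : BarSum k X X' (r + 1) →ₗ[k] P}
    (h : ∀ (Y : A) (f : Y ⟶ X) (b : BarSum k Y X' r), φ (cons f b) = ψ (cons f b)) : φ = ψ := by
  refine hom_ext fun t b => ?_
  cases t with
  | cons Y t =>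
    suffices h' : φ.comp (incl (.cons Y t)) = ψ.comp (incl (.cons Y t)) from
      LinearMap.congr_fun h' b
    exact BarTensor.hom_ext fun f b => by simpa using h Y f (incl t b)

lemma act_cons {X X' Y Y' Z : A} (f : X ⟶ Y) (g : Y' ⟶ X') {r : ℕ} (e : Z ⟶ X)
    (b : BarSum k Z X' r) :
    act f g (r + 1) (cons e b) = cons (e ≫ f) (act (𝟙 Z) g r b) := by
  suffices h : (act f g (r + 1)).comp (cons e) =
      (cons (k := k) (e ≫ f)).comp (act (𝟙 Z) g r) from LinearMap.congr_fun h b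
  exact hom_ext fun t b => by simp [BarTensor.lact_id]

lemma act_act {X X' Y Y' Z Z' : A} (f : X ⟶ Y) (f' : Y ⟶ Z) (g : Y' ⟶ X') (g' : Z' ⟶ Y') (r : ℕ)
    (b : BarSum k X X' r) : act (f ≫ f') (g' ≫ g) r b = act f' g' r (act f g r b) := by
  suffices h : act (f ≫ f') (g' ≫ g) r = (act f' g' r).comp (act (k := k) f g r) from
    LinearMap.congr_fun h b
  exact hom_ext fun t b => by simp [BarTensor.lact_comp, BarTensor.ract_comp, BarTensor.lact_ract]

lemma alpha_act {X X' Y Y' : A} (f : X ⟶ Y) (g : Y' ⟶ X') (r : ℕ) (b : BarSum k X X' (r + 1)) :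
    alpha Y Y' r (act f g (r + 1) b) = act f g r (alpha X X' r b) := by
  suffices h : ∀ (X Y : A) (f : X ⟶ Y), (alpha Y Y' r).comp (act f g (r + 1)) =
      (act f g r).comp (alpha (k := k) X X' r) from LinearMap.congr_fun (h X Y f) b
  clear b f X Y
  intro X Y f
  induction r generalizing X Y with
  | zero =>
    refine hom_ext_cons fun Z e b => ?_
    simp [act_cons, alpha_zero, ← act_act]
  | succ r ih =>
    refine hom_ext_cons fun Z e b => ?_
    have h := LinearMap.congr_fun (ih Z Z (𝟙 Z)) b
    simp only [LinearMap.comp_apply] at h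
    simp [act_cons, alpha_succ, ← act_act, h]

lemma alpha_alpha (X X' : A) (r : ℕ) (b : BarSum k X X' (r + 2)) :
    alpha X X' r (alpha X X' (r + 1) b) = 0 := by
  suffices h : ∀ X : A, (alpha X X' r).comp (alpha X X' (r + 1)) =
      (0 : BarSum k X X' (r + 2) →ₗ[k] BarSum k X X' r) from LinearMap.congr_fun (h X) b
  clear b X
  induction r with
  | zero =>
    intro X
    refine hom_ext_cons fun Y f b => ?_
    simp [alpha_succ, alpha_zero, alpha_act]
  | succ r ih =>
    intro X
    refine hom_ext_cons fun Y f b => ?_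
    have h := LinearMap.congr_fun (ih Y) b
    simp only [LinearMap.comp_apply] at h
    simp [alpha_succ, alpha_act, h]

lemma act_add_left {X X' Y Y' : A} (f₁ f₂ : X ⟶ Y) (g : Y' ⟶ X') (r : ℕ) :
    act (k := k) (f₁ + f₂) g r = act f₁ g r + act f₂ g r :=
  hom_ext fun t b => by simp [BarTensor.lact_add]

lemma act_smul_left {X X' Y Y' : A} (c : k) (f : X ⟶ Y) (g : Y' ⟶ X') (r : ℕ) :
    act (k := k) (c • f) g r = c • act f g r :=
  hom_ext fun t b => by simp [BarTensor.lact_smul]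

lemma act_add_right {X X' Y Y' : A} (f : X ⟶ Y) (g₁ g₂ : Y' ⟶ X') (r : ℕ) :
    act (k := k) f (g₁ + g₂) r = act f g₁ r + act f g₂ r :=
  hom_ext fun t b => by simp [BarTensor.ract_add]

lemma act_smul_right {X X' Y Y' : A} (c : k) (f : X ⟶ Y) (g : Y' ⟶ X') (r : ℕ) :
    act (k := k) f (c • g) r = c • act f g r :=
  hom_ext fun t b => by simp [BarTensor.ract_smul]

lemma act_id (X X' : A) (r : ℕ) : act (k := k) (𝟙 X) (𝟙 X') r = LinearMap.id :=
  hom_ext fun t b => by simp [BarTensor.lact_id, BarTensor.ract_id]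

end BarSum

variable (A) in
/-- The bar complex `Bar(A)`, as a bimodule: the part of degree `n` is `Bar^{-r}(X, X')` if `n = -r`
with `r ≥ 0`, and zero if `n > 0` (it is written as the product over all `r` with `-r = n`, of which
there is at most one). The differential is `α`. -/
noncomputable def Bar : DGBimodule.{w, u, v, max u v} k A where
  obj X X' n := ∀ p : {r : ℕ // -(r : ℤ) = n}, BarSum k X X' (p.1 + 1)
  d {X X'} n m h := LinearMap.pi fun p =>
    (BarSum.alpha X X' (p.1 + 1)).comp 
      (LinearMap.proj (φ := fun q : {r : ℕ // -(r : ℤ) = n} => BarSum k X X' (q.1 + 1))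
        ⟨p.1 + 1, by have := p.2; push_cast; lia⟩)
  d_d := by
    intro X X' n m p h h' b
    ext1 q
    exact BarSum.alpha_alpha X X' (q.1 + 1) _
  act f g n := LinearMap.pi fun p => (BarSum.act f g (p.1 + 1)).comp (LinearMap.proj p)
  act_add_left f₁ f₂ g n b := by
    ext1 p
    exact LinearMap.congr_fun (BarSum.act_add_left f₁ f₂ g (p.1 + 1)) (b p)
  act_smul_left c f g n b := by
    ext1 p
    exact LinearMap.congr_fun (BarSum.act_smul_left c f g (p.1 + 1)) (b p)
  act_add_right f g₁ g₂ n b := by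
    ext1 p
    exact LinearMap.congr_fun (BarSum.act_add_right f g₁ g₂ (p.1 + 1)) (b p)
  act_smul_right c f g n b := by
    ext1 p
    exact LinearMap.congr_fun (BarSum.act_smul_right c f g (p.1 + 1)) (b p)
  act_id {X X'} n b := by
    ext1 p
    exact LinearMap.congr_fun (BarSum.act_id X X' (p.1 + 1)) (b p)
  act_act f f' g g' n b := by
    ext1 p
    exact BarSum.act_act f f' g g' (p.1 + 1) (b p)
  d_act f g n m h b := by
    ext1 p
    exact BarSum.alpha_act f g (p.1 + 1) _

/-- The element `[id_X, id_X]` of `Hom(X ← X) ⊗ Hom(X ← X) ⊆ Bar⁰(X, X)`. -/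
noncomputable def Bar.idId (X : A) : (Bar k A).obj X X 0 :=
  fun p : {r : ℕ // -(r : ℤ) = 0} => match p with
    | ⟨0, _⟩ => BarSum.incl (.cons X .nil) (BarTensor.cons (𝟙 X) (BarTensor.single (𝟙 X)))
    | ⟨_ + 1, hr⟩ => absurd hr (by push_cast; lia)

end Bar

/-! ### `A_∞`-natural transformations -/

section AInfinity

variable (k : Type w) [CommRing k] {A : Type u} [Category.{v} A] [Preadditive A] [Linear k A]
  {B : Type u'} [Category.{v'} B] [Preadditive B] [Linear k B]

/-- The bimodule `M_F^G`, with `M_F^G(X, X') = Hom(F X', G X)` and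
`f · m · g = G(f) ∘ m ∘ F(g)`. -/
noncomputable def homBimodule (F G : A ⥤ Chb B) [F.Additive] [F.Linear k] [G.Additive]
    [G.Linear k] : DGBimodule.{w, u, v, v'} k A where
  obj X X' n := Cochain (F.obj X').obj (G.obj X).obj n
  d {X X'} n m _ := δ_hom k (F.obj X').obj (G.obj X).obj n m
  d_d n m p _ _ b := δ_δ n m p b
  act f g n :=
    { toFun m := (Cochain.ofHom (F.map g).hom).comp
        (m.comp (Cochain.ofHom (G.map f).hom) (add_zero n)) (zero_add n)
      map_add' m m' := by simp
      map_smul' c m := by simp }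
  act_add_left f₁ f₂ g n b := by
    have h : (G.map f₁ + G.map f₂).hom = (G.map f₁).hom + (G.map f₂).hom := rfl
    simp [h]
  act_smul_left c f g n b := by
    have h : (c • G.map f).hom = c • (G.map f).hom := rfl
    ext
    simp [h]
  act_add_right f g₁ g₂ n b := by
    have h : (F.map g₁ + F.map g₂).hom = (F.map g₁).hom + (F.map g₂).hom := rfl
    simp [h]
  act_smul_right c f g n b := by
    have h : (c • F.map g).hom = c • (F.map g).hom := rfl
    ext
    simp [h]
  act_id n b := by simp
  act_act f f' g g' n b := by
    ext
    simp
  d_act f g n m h b := by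
    simp [δ_hom]

/-- A degree `l` `A_∞`-natural transformation `F → G`: a degree `l` bimodule map
`Bar(A) → M_F^G`. -/
noncomputable abbrev AInfNatTrans (F G : A ⥤ Chb B) [F.Additive] [F.Linear k] [G.Additive] [G.Linear k]
    (l : ℤ) :=
  BimoduleHom (Bar k A) (homBimodule k F G) l

variable {k} in
/-- The degree zero `A_∞`-natural transformation `τ` extends `η : H⁰(F) ⟶ H⁰(G)`: for every object
`X`, the element `τ [id_X, id_X]` of `Hom⁰(F X, G X)` is a chain map whose homotopy class is the
component `η_X`. -/
def AInfNatTransExtends {F G : A ⥤ Chb B} [F.Additive] [F.Linear k] [G.Additive] [G.Linear k]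
    (τ : AInfNatTrans k F G 0) (η : H0 F ⟶ H0 G) : Prop :=
  ∀ X : A, ∃ φ : F.obj X ⟶ G.obj X,
    Cochain.ofHom φ.hom = BimoduleHom.app τ X X 0 0 (zero_add 0) (Bar.idId k X) ∧
      (Kb.quotient B).map φ = η.app X

end AInfinity

/-! Existence and uniqueness both reduce to finding a primitive `τ` of a closed bimodule map `σ :
Bar(A) → N` of degree `m`. In bar degree `p`, with `l = m - 1`, the equation reads `d τ_p = σ_p +
(-1)^l τ_{p+1} d`, where `τ_{p+1}` has already been found. The right-hand side is a cocycle of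
degree `p + m`. For `p < -m` it therefore has pointwise primitives, because `N = M_F^G` has no
cohomology in negative degrees. Only the degrees `p ≥ -m` need a hypothesis: `σ` must vanish for `p
> -m` and take values in coboundaries for `p = -m`. This is `BimoduleHom.exists_diff_eq`.

The pointwise primitives must be chosen compatibly with both actions. A bimodule map on `Bar^{-r}`
is freely determined by its values on the elements `[id, f_1, …, f_r, id]`, that is, by `k`-linear
maps on tensor products of `r` hom spaces. These tensor products are projective, so the lifts exist
(`BarSum.exists_lift`).

Uniqueness is the case `m = 0`: the difference of two extensions sends `[id, id]` to a coboundary,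
hence also every `[f, g] = f · [id, id] · g`.

Existence is the case `m = 1`. Choose chain maps `φ_X` representing `η_X`, and let `τ₀ [f, g] = G(f)
∘ φ ∘ F(g)` on `Bar^0` and zero elsewhere. Then `-d τ₀` vanishes on `Bar^0` because the `φ_X` are
chain maps, and is coboundary-valued on `Bar^{-1}` because they are natural up to homotopy. Its
primitive vanishes on `Bar^0`, so adding it to `τ₀` does not change the value at `[id, id]`. -/

section LinearFamilies

variable {k : Type w} [CommRing k] {A : Type u} [Category.{v} A] [Preadditive A] [Linear k A]

/-! ### Relative projectivity of the terms of the bar complex. -/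

namespace DGBimodule

/-- For a fixed element `b`, the map `(f, g) ↦ f · b · g` is linear in `g`. -/
def ractHom (N : DGBimodule.{w, u, v, y} k A) {X X' : A} (Y' : A) (n : ℤ) :
    N.obj X X' n →ₗ[k] (Y' ⟶ X') →ₗ[k] N.obj X Y' n :=
  LinearMap.mk₂ k (fun b g => N.act (𝟙 X) g n b) (by simp) (by simp)
    (fun b g g' => N.act_add_right _ _ _ _ _) (fun c b g => N.act_smul_right _ _ _ _ _)

@[simp]
lemma ractHom_apply (N : DGBimodule.{w, u, v, y} k A) {X X' Y' : A} (n : ℤ) (b : N.obj X X' n)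
    (g : Y' ⟶ X') : N.ractHom Y' n b g = N.act (𝟙 X) g n b := rfl

/-- For a fixed element `b`, the map `f ↦ f · b` is linear in `f`. -/
def lactHom (N : DGBimodule.{w, u, v, y} k A) {X X' : A} (Y : A) (n : ℤ) :
    (X ⟶ Y) →ₗ[k] N.obj X X' n →ₗ[k] N.obj Y X' n :=
  LinearMap.mk₂ k (fun f b => N.act f (𝟙 X') n b)
    (fun f f' b => N.act_add_left _ _ _ _ _) (fun c f b => N.act_smul_left _ _ _ _ _)
    (by simp) (by simp)

@[simp]
lemma lactHom_apply (N : DGBimodule.{w, u, v, y} k A) {X X' Y : A} (n : ℤ) (f : X ⟶ Y)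
    (b : N.obj X X' n) : N.lactHom Y n f b = N.act f (𝟙 X') n b := rfl

lemma act_act_id (N : DGBimodule.{w, u, v, y} k A) {X X' Y Y' Z' : A} (f : X ⟶ Y)
    (g : Y' ⟶ X') (g' : Z' ⟶ Y') (n : ℤ) (b : N.obj X X' n) :
    N.act (𝟙 Y) g' n (N.act f g n b) = N.act f (g' ≫ g) n b := by
  rw [← N.act_act, Category.comp_id]

lemma act_id_act (N : DGBimodule.{w, u, v, y} k A) {X X' Y Y' Z : A} (f : X ⟶ Y) (f' : Y ⟶ Z)
    (g : Y' ⟶ X') (n : ℤ) (b : N.obj X X' n) :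
    N.act f' (𝟙 Y') n (N.act f g n b) = N.act (f ≫ f') g n b := by
  rw [← N.act_act, Category.id_comp]

end DGBimodule

/-- Families of linear maps out of `W ⊗ BarTensor`, compatible with the right action and with
values in coboundaries, lift along the differential if `W` is projective. -/
lemma BarTensor.exists_lift_of_projective (hA : ∀ X Y : A, Module.Projective k (X ⟶ Y))
    (N : DGBimodule.{w, u, v, y} k A) {n m : ℤ} (h : n + 1 = m) (X₀ : A) {r : ℕ}
    (t : ObjTuple A r) : ∀ (Y : A) (W : Type (max v w)) [AddCommGroup W] [Module k W]
    [Module.Projective k W] (ρ : ∀ X' : A, W →ₗ[k] BarTensor k X' Y t →ₗ[k] N.obj X₀ X' m)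
    (_ : ∀ (X' Y' : A) (g : Y' ⟶ X') (c : W) (b : BarTensor k X' Y t),
      ρ Y' c (BarTensor.ract g t b) = N.act (𝟙 X₀) g m (ρ X' c b))
    (_ : ∀ (X' : A) (c : W) (b : BarTensor k X' Y t), ρ X' c b ∈ LinearMap.range (N.d n m h)),
    ∃ τ : ∀ X' : A, W →ₗ[k] BarTensor k X' Y t →ₗ[k] N.obj X₀ X' n,
      (∀ (X' Y' : A) (g : Y' ⟶ X') (c : W) (b : BarTensor k X' Y t),
        τ Y' c (BarTensor.ract g t b) = N.act (𝟙 X₀) g n (τ X' c b)) ∧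
      ∀ (X' : A) (c : W) (b : BarTensor k X' Y t), N.d n m h (τ X' c b) = ρ X' c b := by
  induction t with
  | nil =>
    intro Y W _ _ _ ρ hρ hr
    -- Yoneda in the last variable: a right-equivariant family on `Hom(Y ← X')` is determined by its
    -- value at `𝟙 Y`, so it is enough to lift one linear map out of the projective module `W`.
    let e : W →ₗ[k] N.obj X₀ Y m := (ρ Y).flip (BarTensor.single (𝟙 Y))
    obtain ⟨q, hq⟩ := Module.projective_lifting_property
      (N.d (X := X₀) (X' := Y) n m h).rangeRestrict
      (e.codRestrict _ fun c => hr Y c _) (LinearMap.surjective_rangeRestrict _)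
    have hq' (c : W) : N.d n m h (q c) = ρ Y c (BarTensor.single (𝟙 Y)) :=
      congrArg Subtype.val (LinearMap.congr_fun hq c)
    refine ⟨fun X' => ((N.ractHom X' n).comp q).compl₂ BarTensor.single.symm.toLinearMap, ?_, ?_⟩
    · intro X' Y' g c b
      obtain ⟨b, rfl⟩ := BarTensor.single.surjective b
      simp [N.act_act_id]
    · intro X' c b
      obtain ⟨b, rfl⟩ := BarTensor.single.surjective b
      have := hρ Y X' b c (BarTensor.single (𝟙 Y))
      simp only [BarTensor.ract_single, Category.comp_id] at this
      simp [N.d_act, hq', this]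
  | cons Z t ih =>
    intro Y W _ _ _ ρ hρ hr
    have := hA Z Y
    -- The first tensor factor is absorbed into the coefficient module, which stays projective. This
    -- is why `W` is arbitrary in the induction.
    obtain ⟨τ, hτ, hτ'⟩ := ih Z (W ⊗[k] (Z ⟶ Y))
      (fun X' => TensorProduct.lift
        (LinearMap.mk₂ k (fun c f => (ρ X' c).comp (BarTensor.cons f))
          (by intros; ext; simp) (by intros; ext; simp) (by intros; ext; simp)
          (by intros; ext; simp)))
      (by
        intro X' Y' g c b
        induction c with
        | zero => simp
        | add c c' h h' => simp [h, h']
        | tmul c f => simpa using hρ X' Y' g c (BarTensor.cons f b))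
      (by
        intro X' c b
        induction c with
        | zero => simp
        | add c c' h h' => simpa using add_mem h h'
        | tmul c f => exact hr X' c (BarTensor.cons f b))
    let τ' (X' : A) : W →ₗ[k] BarTensor k X' Y (.cons Z t) →ₗ[k] N.obj X₀ X' n :=
      LinearMap.mk₂ k
        (fun c => BarTensor.lift ((τ X').comp (TensorProduct.mk k W (Z ⟶ Y) c)))
        (by
          intro c c' b
          rw [← LinearMap.add_apply]
          revert b
          refine LinearMap.congr_fun (BarTensor.hom_ext fun f b => ?_)
          simp)
        (by
          intro a c b
          rw [← LinearMap.smul_apply]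
          revert b
          refine LinearMap.congr_fun (BarTensor.hom_ext fun f b => ?_)
          simp)
        (by simp) (by simp)
    have e (X' : A) (c : W) (f : Z ⟶ Y) (b : BarTensor k X' Z t) :
        τ' X' c (BarTensor.cons f b) = τ X' (c ⊗ₜ f) b := by simp [τ']
    refine ⟨τ', ?_, ?_⟩
    · intro X' Y' g c
      suffices h : (τ' Y' c).comp (BarTensor.ract g (.cons Z t)) =
        (N.act (𝟙 X₀) g n).comp (τ' X' c) from LinearMap.congr_fun h
      exact BarTensor.hom_ext fun f b => by simp [e, hτ]
    · intro X' c
      suffices h : (N.d n m h).comp (τ' X' c) = ρ X' c from LinearMap.congr_fun h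
      exact BarTensor.hom_ext fun f b => by simp [e, hτ']

/-- The linear map `[f, f₀, f₁, …] ↦ f · β [f₀, f₁, …]` on the direct sum. -/
noncomputable def BarSum.extend (N : DGBimodule.{w, u, v, y} k A) {n : ℤ} {r : ℕ}
    (β : ∀ (X₀ X' : A) (t : ObjTuple A r), BarTensor k X' X₀ t →ₗ[k] N.obj X₀ X' n) (X X' : A) :
    BarSum k X X' (r + 1) →ₗ[k] N.obj X X' n :=
  BarSum.desc fun
    | .cons X₀ t => BarTensor.lift ((N.lactHom X n).compl₂ (β X₀ X' t))

@[simp]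
lemma BarSum.extend_cons (N : DGBimodule.{w, u, v, y} k A) {n : ℤ} {r : ℕ}
    (β : ∀ (X₀ X' : A) (t : ObjTuple A r), BarTensor k X' X₀ t →ₗ[k] N.obj X₀ X' n) {X X' X₀ : A}
    (f : X₀ ⟶ X) (t : ObjTuple A r) (b : BarTensor k X' X₀ t) :
    BarSum.extend N β X X' (BarSum.incl (.cons X₀ t) (BarTensor.cons f b)) =
      N.act f (𝟙 X') n (β X₀ X' t b) := by
  simp [BarSum.extend]

/-- The left action only changes the entry `f` of `[f, f₀, …]`, so left equivariance is automatic
and right equivariance is inherited from `β`. -/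
lemma BarSum.extend_act (N : DGBimodule.{w, u, v, y} k A) {n : ℤ} {r : ℕ}
    (β : ∀ (X₀ X' : A) (t : ObjTuple A r), BarTensor k X' X₀ t →ₗ[k] N.obj X₀ X' n)
    (hβ : ∀ (X₀ X' Y' : A) (g : Y' ⟶ X') (t : ObjTuple A r) (b : BarTensor k X' X₀ t),
      β X₀ Y' t (BarTensor.ract g t b) = N.act (𝟙 X₀) g n (β X₀ X' t b))
    {X X' Y Y' : A} (f : X ⟶ Y) (g : Y' ⟶ X') (b : BarSum k X X' (r + 1)) :
    BarSum.extend N β Y Y' (BarSum.act f g (r + 1) b) =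
      N.act f g n (BarSum.extend N β X X' b) := by
  suffices h : (BarSum.extend N β Y Y').comp (BarSum.act f g (r + 1)) =
    (N.act f g n).comp (BarSum.extend N β X X') from LinearMap.congr_fun h b
  refine BarSum.hom_ext fun t b => ?_
  cases t with
  | cons Z t =>
    suffices h : ((BarSum.extend N β Y Y').comp (BarSum.act f g (r + 1))).comp
        (BarSum.incl (.cons Z t)) = ((N.act f g n).comp (BarSum.extend N β X X')).comp
        (BarSum.incl (.cons Z t)) from LinearMap.congr_fun h b
    exact BarTensor.hom_ext fun e b => by simp [hβ, ← N.act_act]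

/-- `Bar^{-r}` is a relatively projective bimodule: bimodule maps with values in coboundaries lift
along the differential. -/
lemma BarSum.exists_lift (hA : ∀ X Y : A, Module.Projective k (X ⟶ Y))
    (N : DGBimodule.{w, u, v, y} k A) {n m : ℤ} (h : n + 1 = m) {r : ℕ}
    (ρ : ∀ X X' : A, BarSum k X X' (r + 1) →ₗ[k] N.obj X X' m)
    (hρ : ∀ (X X' Y Y' : A) (f : X ⟶ Y) (g : Y' ⟶ X') (b : BarSum k X X' (r + 1)),
      ρ Y Y' (BarSum.act f g (r + 1) b) = N.act f g m (ρ X X' b))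
    (hr : ∀ (X X' : A) (b : BarSum k X X' (r + 1)), ∃ c, N.d n m h c = ρ X X' b) :
    ∃ τ : ∀ X X' : A, BarSum k X X' (r + 1) →ₗ[k] N.obj X X' n,
      (∀ (X X' Y Y' : A) (f : X ⟶ Y) (g : Y' ⟶ X') (b : BarSum k X X' (r + 1)),
        τ Y Y' (BarSum.act f g (r + 1) b) = N.act f g n (τ X X' b)) ∧
      ∀ (X X' : A) (b : BarSum k X X' (r + 1)), N.d n m h (τ X X' b) = ρ X X' b := by
  have key (X₀ : A) (t : ObjTuple A r) :
      ∃ β : ∀ X' : A, BarTensor k X' X₀ t →ₗ[k] N.obj X₀ X' n,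
        (∀ (X' Y' : A) (g : Y' ⟶ X') (b : BarTensor k X' X₀ t),
          β Y' (BarTensor.ract g t b) = N.act (𝟙 X₀) g n (β X' b)) ∧
        ∀ (X' : A) (b : BarTensor k X' X₀ t), N.d n m h (β X' b) =
          ρ X₀ X' (BarSum.incl (.cons X₀ t) (BarTensor.cons (𝟙 X₀) b)) := by
    -- The induction starts with coefficients `W = k`, lifted to the universe in which all the later
    -- modules `W ⊗ Hom` live. The lift `β` is then the value at `1`.
    have : Module.Projective k (ULift.{v} k) :=
      Module.Projective.of_equiv (ULift.moduleEquiv (R := k) (M := k)).symm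
    obtain ⟨τ, hτ, hτ'⟩ := BarTensor.exists_lift_of_projective hA N h X₀ t X₀ (ULift.{v} k)
      (fun X' => (LinearMap.toSpanSingleton k _ ((ρ X₀ X').comp
        ((BarSum.incl (.cons X₀ t)).comp (BarTensor.cons (𝟙 X₀))))).comp
        (ULift.moduleEquiv (R := k) (M := k)).toLinearMap)
      (by
        intro X' Y' g c b
        have := hρ X₀ X' X₀ Y' (𝟙 X₀) g (BarSum.incl (.cons X₀ t) (BarTensor.cons (𝟙 X₀) b))
        simp at this
        simp [this])
      (fun X' c b => Submodule.smul_mem _ _ (hr _ _ _))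
    exact ⟨fun X' => τ X' ⟨1⟩, fun X' Y' g b => hτ X' Y' g _ b, fun X' b => by simp [hτ']⟩
  choose β hβ hβ' using key
  refine ⟨BarSum.extend N fun X₀ X' t => β X₀ t X',
    fun X X' Y Y' f g b => BarSum.extend_act N _ (fun X₀ X' Y' g t b => hβ X₀ t X' Y' g b) f g b,
    fun X X' b => ?_⟩
  suffices h : (N.d n m h).comp (BarSum.extend N (fun X₀ X' t => β X₀ t X') X X') = ρ X X' from
    LinearMap.congr_fun h b
  refine BarSum.hom_ext fun t b => ?_
  cases t with
  | cons Z t =>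
    suffices h : ((N.d n m h).comp (BarSum.extend N (fun X₀ X' t => β X₀ t X') X X')).comp
      (BarSum.incl (.cons Z t)) = (ρ X X').comp (BarSum.incl (.cons Z t)) from
      LinearMap.congr_fun h b
    refine BarTensor.hom_ext fun f b => ?_
    -- Here `[f, b] = f · [id, b]`, so the equation on elements beginning with an identity implies
    -- it everywhere.
    have := hρ Z X' X X' f (𝟙 X') (BarSum.incl (.cons Z t) (BarTensor.cons (𝟙 Z) b))
    simp [BarTensor.ract_id] at this
    simp [N.d_act, hβ', this]

end LinearFamilies

/-! ### The complex of bimodule maps. -/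

namespace BimoduleHom

variable {k : Type w} [CommRing k] {A : Type u} [Category.{v} A] [Preadditive A] [Linear k A]
  {M : DGBimodule.{w, u, v, x} k A} {N : DGBimodule.{w, u, v, y} k A}

lemma ext_app {l : ℤ} {τ τ' : BimoduleHom M N l}
    (h : ∀ (X X' : A) (p q : ℤ) (hpq : p + l = q) (b : M.obj X X' p),
      app τ X X' p q hpq b = app τ' X X' p q hpq b) : τ = τ' :=
  Subtype.ext (funext fun X => funext fun X' => funext fun T =>
    LinearMap.ext (h X X' T.p T.q T.hpq))

@[simp]
lemma app_zero {l : ℤ} (X X' : A) (p q : ℤ) (h : p + l = q) (b : M.obj X X' p) :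
    app (0 : BimoduleHom M N l) X X' p q h b = 0 := rfl

@[simp]
lemma app_add {l : ℤ} (τ τ' : BimoduleHom M N l) (X X' : A) (p q : ℤ) (h : p + l = q)
    (b : M.obj X X' p) :
    app (τ + τ') X X' p q h b = app τ X X' p q h b + app τ' X X' p q h b := rfl

@[simp]
lemma app_neg {l : ℤ} (τ : BimoduleHom M N l) (X X' : A) (p q : ℤ) (h : p + l = q)
    (b : M.obj X X' p) : app (-τ) X X' p q h b = -app τ X X' p q h b := rfl

@[simp]
lemma app_sub {l : ℤ} (τ τ' : BimoduleHom M N l) (X X' : A) (p q : ℤ) (h : p + l = q)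
    (b : M.obj X X' p) :
    app (τ - τ') X X' p q h b = app τ X X' p q h b - app τ' X X' p q h b := rfl

@[simp]
lemma app_units_smul {l : ℤ} (c : ℤˣ) (τ : BimoduleHom M N l) (X X' : A) (p q : ℤ)
    (h : p + l = q) (b : M.obj X X' p) : app (c • τ) X X' p q h b = c • app τ X X' p q h b := rfl

/-- The degrees are free variables tied by equations, so the formula applies where they agree with
`p + 1` or `p + l` only up to a provable equality. -/
lemma app_diff {l m : ℤ} (h : l + 1 = m) (τ : BimoduleHom M N l) (X X' : A) {p p' q q' : ℤ}
    (hp : p + 1 = p') (hq : q + 1 = q') (hpq : p + l = q) (hpq' : p + m = q') (b : M.obj X X' p) :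
    app (diff l m h τ) X X' p q' hpq' b = N.d q q' hq (app τ X X' p q hpq b) -
      l.negOnePow • app τ X X' p' q' (by lia) (M.d p p' hp b) := by
  subst hp hpq
  rfl

lemma diff_add {l m : ℤ} (h : l + 1 = m) (τ τ' : BimoduleHom M N l) :
    diff l m h (τ + τ') = diff l m h τ + diff l m h τ' := by
  refine ext_app fun X X' p q hpq b => ?_
  simp only [app_add, app_diff h _ X X' rfl (show (p + l) + 1 = q by lia) rfl hpq, map_add,
    smul_add]
  abel

lemma diff_neg {l m : ℤ} (h : l + 1 = m) (τ : BimoduleHom M N l) :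
    diff l m h (-τ) = -diff l m h τ := by
  rw [eq_neg_iff_add_eq_zero, ← diff_add, neg_add_cancel]
  refine ext_app fun X X' p q hpq b => ?_
  simp [app_diff h _ X X' rfl (show (p + l) + 1 = q by lia) rfl hpq]

lemma diff_sub {l m : ℤ} (h : l + 1 = m) (τ τ' : BimoduleHom M N l) :
    diff l m h (τ - τ') = diff l m h τ - diff l m h τ' := by
  rw [sub_eq_add_neg, diff_add, diff_neg, sub_eq_add_neg]

/-- The two mixed terms `d ∘ τ ∘ d` carry the signs `(-1)^l` and `(-1)^{l+1}` and cancel. -/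
lemma diff_diff {l m n : ℤ} (h : l + 1 = m) (h' : m + 1 = n) (τ : BimoduleHom M N l) :
    diff m n h' (diff l m h τ) = 0 := by
  refine ext_app fun X X' p q hpq b => ?_
  rw [app_diff h' _ X X' rfl (show (p + m) + 1 = q by lia) rfl hpq,
    app_diff h _ X X' rfl (show (p + l) + 1 = p + m by lia) rfl rfl,
    app_diff h _ X X' rfl (show (p + m) + 1 = q by lia) (by lia) (by lia)]
  subst h
  simp [N.d_d, M.d_d, Int.negOnePow_succ, Units.smul_def]

lemma IsClosed.app_d {m : ℤ} {σ : BimoduleHom M N m} (hσ : IsClosed σ) (X X' : A)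
    {p p' q q' : ℤ} (hp : p + 1 = p') (hq : q + 1 = q') (hpq : p + m = q) (hpq' : p' + m = q')
    (b : M.obj X X' p) :
    N.d q q' hq (app σ X X' p q hpq b) = m.negOnePow • app σ X X' p' q' hpq' (M.d p p' hp b) := by
  rw [← sub_eq_zero, ← app_diff rfl σ X X' hp hq hpq (by lia) b, hσ]
  rfl

/-- The composition `τ ∘ d` of a bimodule map with the differential. -/
def compD {l m : ℤ} (h : l + 1 = m) (τ : BimoduleHom M N l) : BimoduleHom M N m :=
  ⟨fun X X' T => (app τ X X' (T.p + 1) T.q (by have := T.hpq; lia)).comp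
    (M.d T.p (T.p + 1) rfl), by
    intro X X' Y Y' f g T b
    simp [app_act, DGBimodule.d_act]⟩

lemma app_compD {l m : ℤ} (h : l + 1 = m) (τ : BimoduleHom M N l) (X X' : A) {p p' q : ℤ}
    (hp : p + 1 = p') (hpq : p + m = q) (b : M.obj X X' p) :
    app (compD h τ) X X' p q hpq b = app τ X X' p' q (by lia) (M.d p p' hp b) := by
  subst hp
  rfl

/-- The bimodule map concentrated in a single degree. -/
noncomputable def single {l : ℤ} (p q : ℤ) (h : p + l = q)
    (φ : ∀ X X' : A, M.obj X X' p →ₗ[k] N.obj X X' q)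
    (hφ : ∀ (X X' Y Y' : A) (f : X ⟶ Y) (g : Y' ⟶ X') (b : M.obj X X' p),
      φ Y Y' (M.act f g p b) = N.act f g q (φ X X' b)) : BimoduleHom M N l := by
  classical
  exact ⟨fun X X' T => if hT : T.p = p then
      (show M.obj X X' T.p →ₗ[k] N.obj X X' T.q by
        obtain ⟨p', q', h'⟩ := T; subst hT h h'; exact φ X X')
      else 0, by
    rintro X X' Y Y' f g ⟨p', q', h'⟩ b
    by_cases hT : p' = p
    · subst hT h h'
      simpa using hφ X X' Y Y' f g b
    · simp [hT]⟩

section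

variable {l : ℤ} (p q : ℤ) (h : p + l = q)
    (φ : ∀ X X' : A, M.obj X X' p →ₗ[k] N.obj X X' q)
    (hφ : ∀ (X X' Y Y' : A) (f : X ⟶ Y) (g : Y' ⟶ X') (b : M.obj X X' p),
      φ Y Y' (M.act f g p b) = N.act f g q (φ X X' b))

lemma app_single (X X' : A) : app (single p q h φ hφ) X X' p q h = φ X X' := by
  subst h
  simp [app, single]

lemma app_single_of_ne (X X' : A) (p' q' : ℤ) (h' : p' + l = q') (hp : p' ≠ p) :
    app (single p q h φ hφ) X X' p' q' h' = 0 := by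
  simp [app, single, hp]

end

end BimoduleHom

/-! ### Primitives of closed maps on the bar complex, by descent in the bar degree. -/

section Bar

variable {k : Type w} [CommRing k] {A : Type u} [Category.{v} A] [Preadditive A] [Linear k A]

/-- The terms of the bar complex. -/
noncomputable def Bar.equiv (X X' : A) (r : ℕ) (n : ℤ) (h : -(r : ℤ) = n) :
    (Bar k A).obj X X' n ≃ₗ[k] BarSum k X X' (r + 1) where
  toFun b := b ⟨r, h⟩
  map_add' _ _ := rfl
  map_smul' _ _ := rfl
  -- The index type has exactly one element, so `c` only has to be transported along `r = p.1`.
  invFun c p := (show r = p.1 by have := p.2; lia) ▸ c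
  left_inv b := by
    funext ⟨p, hp⟩
    obtain rfl : r = p := by lia
    rfl
  right_inv c := rfl

lemma Bar.equiv_act {X X' Y Y' : A} (f : X ⟶ Y) (g : Y' ⟶ X') (r : ℕ) (n : ℤ)
    (h : -(r : ℤ) = n) (b : (Bar k A).obj X X' n) :
    Bar.equiv Y Y' r n h ((Bar k A).act f g n b) =
      BarSum.act f g (r + 1) (Bar.equiv X X' r n h b) := rfl

lemma Bar.equiv_d (X X' : A) (r : ℕ) (n m : ℤ) (hn : -((r + 1 : ℕ) : ℤ) = n) (hm : -(r : ℤ) = m)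
    (h : n + 1 = m) (b : (Bar k A).obj X X' n) :
    Bar.equiv X X' r m hm ((Bar k A).d n m h b) =
      BarSum.alpha X X' (r + 1) (Bar.equiv X X' (r + 1) n hn b) := rfl

lemma Bar.equiv_idId (X : A) (h : -((0 : ℕ) : ℤ) = 0) :
    Bar.equiv X X 0 0 h (Bar.idId k X) =
      BarSum.incl (.cons X .nil) (BarTensor.cons (𝟙 X) (BarTensor.single (𝟙 X))) := rfl

lemma Bar.eq_zero_of_pos {X X' : A} {n : ℤ} (hn : 0 < n) (b : (Bar k A).obj X X' n) : b = 0 := by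
  funext ⟨p, hp⟩
  lia

lemma Bar.equiv_symm_act {X X' Y Y' : A} (f : X ⟶ Y) (g : Y' ⟶ X') (r : ℕ) (n : ℤ)
    (h : -(r : ℤ) = n) (b : BarSum k X X' (r + 1)) :
    (Bar.equiv Y Y' r n h).symm (BarSum.act f g (r + 1) b) =
      (Bar k A).act f g n ((Bar.equiv X X' r n h).symm b) := by
  rw [LinearEquiv.symm_apply_eq, Bar.equiv_act, LinearEquiv.apply_symm_apply]

namespace BimoduleHom

variable {N : DGBimodule.{w, u, v, y} k A}

/-- A bimodule map on the bar complex which takes values in coboundaries in degree `p` lifts along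
the differential in this degree. -/
lemma exists_lift (hA : ∀ X Y : A, Module.Projective k (X ⟶ Y)) {l m : ℤ}
    (ρ : BimoduleHom (Bar k A) N m) (p q q' : ℤ) (hpq : p + l = q) (hpq' : p + m = q')
    (hq : q + 1 = q')
    (hρ : ∀ (X X' : A) (b : (Bar k A).obj X X' p), ∃ c, N.d q q' hq c = app ρ X X' p q' hpq' b) :
    ∃ τ : BimoduleHom (Bar k A) N l, ∀ (X X' : A) (b : (Bar k A).obj X X' p),
      N.d q q' hq (app τ X X' p q hpq b) = app ρ X X' p q' hpq' b := by
  obtain hp | hp := lt_or_ge 0 p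
  · refine ⟨0, fun X X' b => ?_⟩
    rw [Bar.eq_zero_of_pos hp b]
    simp
  · obtain ⟨r, hr⟩ : ∃ r : ℕ, -(r : ℤ) = p := ⟨(-p).toNat, by lia⟩
    obtain ⟨τ, hτ, hτ'⟩ := BarSum.exists_lift hA N hq
      (fun X X' => (app ρ X X' p q' hpq').comp (Bar.equiv X X' r p hr).symm.toLinearMap)
      (fun X X' Y Y' f g b => by simp [Bar.equiv_symm_act, app_act])
      (fun X X' b => hρ X X' _)
    refine ⟨single p q hpq (fun X X' => (τ X X').comp (Bar.equiv X X' r p hr).toLinearMap)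
      (fun X X' Y Y' f g b => by simp [Bar.equiv_act, hτ]), fun X X' b => ?_⟩
    simp [app_single, hτ']

/-- The inductive step of `exists_diff_eq`: solving for a primitive in the single degree `p`. -/
lemma exists_primitive (hA : ∀ X Y : A, Module.Projective k (X ⟶ Y))
    (hN : ∀ (X X' : A) (n p q : ℤ) (hn : n + 1 = p) (hp : p + 1 = q) (b : N.obj X X' p), p < 0 →
      N.d p q hp b = 0 → ∃ c, N.d n p hn c = b)
    {l m : ℤ} (h : l + 1 = m) (ρ : BimoduleHom (Bar k A) N m) (p : ℤ)
    (hlt : ∀ (X X' : A) (q : ℤ) (hpq : p + m = q) (b : (Bar k A).obj X X' p), -m < p →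
      app ρ X X' p q hpq b = 0)
    (heq : ∀ (X X' : A) (n q : ℤ) (hpq : p + m = q) (hn : n + 1 = q)
      (b : (Bar k A).obj X X' p), p = -m → ∃ c, N.d n q hn c = app ρ X X' p q hpq b)
    (hgt : ∀ (X X' : A) (q q' : ℤ) (hpq : p + m = q) (hq : q + 1 = q')
      (b : (Bar k A).obj X X' p), p < -m → N.d q q' hq (app ρ X X' p q hpq b) = 0) :
    ∃ τ : BimoduleHom (Bar k A) N l,
      (∀ (X X' : A) (q q' : ℤ) (hpq : p + l = q) (hq : q + 1 = q')
        (b : (Bar k A).obj X X' p),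
        N.d q q' hq (app τ X X' p q hpq b) = app ρ X X' p q' (by lia) b) ∧
      (∀ (X X' : A) (q : ℤ) (hpq : p + l = q) (b : (Bar k A).obj X X' p), -m < p →
        app τ X X' p q hpq b = 0) := by
  obtain hp | hp := lt_or_ge (-m) p
  · exact ⟨0, fun X X' q q' hpq hq b => by simp [hlt X X' q' (by lia) b hp], by simp⟩
  · obtain ⟨τ, hτ⟩ := exists_lift hA (l := l) ρ p (p + l) (p + m) rfl rfl (by lia)
      (fun X X' b => by
        -- For `p < -m` the value is a cocycle in the negative degree `p + m`, hence exact by `hN`;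
        -- for `p = -m` it is exact by `heq`.
        obtain hp | hp := hp.lt_or_eq
        · exact hN X X' (p + l) (p + m) (p + m + 1) (by lia) rfl _ (by lia)
            (hgt X X' _ _ rfl rfl b hp)
        · exact heq X X' _ _ rfl (by lia) b hp)
    refine ⟨τ, fun X X' q q' hpq hq b => ?_, fun X X' q hpq b hp' => by lia⟩
    obtain rfl : p + m = q' := by lia
    subst hpq
    exact hτ X X' b

/-- `τ` is a possible component in degree `p` of a primitive of `σ`: the next obstruction is
closed, and `τ` vanishes if `p > -m`. -/
structure IsPartialPrimitive {l m : ℤ} (h : l + 1 = m) (σ : BimoduleHom (Bar k A) N m)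
    (τ : BimoduleHom (Bar k A) N l) (p : ℤ) : Prop where
  d_app_d : ∀ (X X' : A) (p' q q' : ℤ) (hp : p' + 1 = p) (hpq : p + l = q) (hq : q + 1 = q')
    (b : (Bar k A).obj X X' p'), N.d q q' hq (app τ X X' p q hpq ((Bar k A).d p' p hp b)) =
      app σ X X' p q' (by lia) ((Bar k A).d p' p hp b)
  eq_zero : ∀ (X X' : A) (q : ℤ) (hpq : p + l = q) (b : (Bar k A).obj X X' p), -m < p →
    app τ X X' p q hpq b = 0

/-- The next right-hand side `σ_p + (-1)^l τ_{p+1} d` is a cocycle: its two terms have differentials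
`(-1)^m σ d` and `(-1)^l σ d`, with `m = l + 1`. For this, `d τ_{p+1} = σ_{p+1}` is needed only
after composing with the bar differential, and `d_d` gives that weaker equation again for the new
component. The invariant thus involves one component at a time. -/
lemma IsPartialPrimitive.exists_next (hA : ∀ X Y : A, Module.Projective k (X ⟶ Y))
    (hN : ∀ (X X' : A) (n p q : ℤ) (hn : n + 1 = p) (hp : p + 1 = q) (b : N.obj X X' p), p < 0 →
      N.d p q hp b = 0 → ∃ c, N.d n p hn c = b)
    {l m : ℤ} (h : l + 1 = m) (σ : BimoduleHom (Bar k A) N m) (hσ : IsClosed σ)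
    (hlt : ∀ (X X' : A) (p q : ℤ) (hpq : p + m = q) (b : (Bar k A).obj X X' p), -m < p →
      app σ X X' p q hpq b = 0)
    (heq : ∀ (X X' : A) (p n q : ℤ) (hpq : p + m = q) (hn : n + 1 = q)
      (b : (Bar k A).obj X X' p), p = -m → ∃ c, N.d n q hn c = app σ X X' p q hpq b)
    (τ : BimoduleHom (Bar k A) N l) (p p' : ℤ) (hp : p + 1 = p')
    (hτ : IsPartialPrimitive h σ τ p') :
    ∃ τ' : BimoduleHom (Bar k A) N l, IsPartialPrimitive h σ τ' p ∧
      ∀ (X X' : A) (q q' : ℤ) (hpq : p + l = q) (hq : q + 1 = q') (b : (Bar k A).obj X X' p),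
        N.d q q' hq (app τ' X X' p q hpq b) = app σ X X' p q' (by lia) b +
          l.negOnePow • app τ X X' p' q' (by lia) ((Bar k A).d p p' hp b) := by
  have hd (X X' : A) (q : ℤ) (hpq : p + m = q) (b : (Bar k A).obj X X' p) :
      app (σ + l.negOnePow • compD h τ) X X' p q hpq b = app σ X X' p q hpq b +
        l.negOnePow • app τ X X' p' q (by lia) ((Bar k A).d p p' hp b) := by
    rw [app_add, app_units_smul, app_compD h τ X X' hp hpq]
  obtain ⟨τ', hτ₁, hτ₂⟩ := exists_primitive hA hN h (σ + l.negOnePow • compD h τ) p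
    (fun X X' q hpq b hp' => by
      rw [hd, hlt X X' p q hpq b hp', hτ.eq_zero X X' q (by lia) _ (by lia), smul_zero, add_zero])
    -- At `p = -m` the previous component sits in degree `-m + 1`, where it vanishes, so only `σ`
    -- remains.
    (fun X X' n q hpq hn b hp' => by
      rw [hd, hτ.eq_zero X X' q (by lia) _ (by lia), smul_zero, add_zero]
      exact heq X X' p n q hpq hn b hp')
    (fun X X' q q' hpq hq b hp' => by
      rw [hd, map_add, hσ.app_d X X' hp hq hpq (by lia) b, Units.smul_def l.negOnePow, map_zsmul,
        hτ.d_app_d X X' p q q' hp (by lia) hq b]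
      subst h
      simp [Int.negOnePow_succ, Units.smul_def])
  have hR (X X' : A) (q q' : ℤ) (hpq : p + l = q) (hq : q + 1 = q')
      (b : (Bar k A).obj X X' p) :
      N.d q q' hq (app τ' X X' p q hpq b) = app σ X X' p q' (by lia) b +
        l.negOnePow • app τ X X' p' q' (by lia) ((Bar k A).d p p' hp b) := by
    rw [hτ₁ X X' q q' hpq hq b, hd]
  refine ⟨τ', ⟨fun X X' p'' q q' hp' hpq hq b => ?_, hτ₂⟩, hR⟩
  rw [hR X X' q q' hpq hq, (Bar k A).d_d, map_zero, smul_zero, add_zero]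

/-- Gluing the components of a primitive. -/
lemma exists_diff_eq_of_sequence {l m : ℤ} (h : l + 1 = m) (σ : BimoduleHom (Bar k A) N m)
    (T : ℕ → BimoduleHom (Bar k A) N l)
    (hzero : ∀ (X X' : A) (q q' : ℤ) (hpq : 0 + l = q) (hq : q + 1 = q')
      (b : (Bar k A).obj X X' 0), N.d q q' hq (app (T 0) X X' 0 q hpq b) =
        app σ X X' 0 q' (by lia) b)
    (hsucc : ∀ (r : ℕ) (X X' : A) (p p' q q' : ℤ) (hr : -(r : ℤ) = p') (hp : p + 1 = p')
      (hpq : p + l = q) (hq : q + 1 = q') (b : (Bar k A).obj X X' p),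
      N.d q q' hq (app (T (r + 1)) X X' p q hpq b) = app σ X X' p q' (by lia) b +
        l.negOnePow • app (T r) X X' p' q' (by lia) ((Bar k A).d p p' hp b)) :
    ∃ τ : BimoduleHom (Bar k A) N l, diff l m h τ = σ ∧
      ∀ (r : ℕ) (X X' : A) (p q : ℤ) (_ : -(r : ℤ) = p) (hpq : p + l = q)
        (b : (Bar k A).obj X X' p), app τ X X' p q hpq b = app (T r) X X' p q hpq b := by
  obtain ⟨τ, hτ⟩ : ∃ τ : BimoduleHom (Bar k A) N l, ∀ (r : ℕ) (X X' : A) (p q : ℤ)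
      (_ : -(r : ℤ) = p) (hpq : p + l = q) (b : (Bar k A).obj X X' p),
      app τ X X' p q hpq b = app (T r) X X' p q hpq b := by
    -- Each `T r` contributes only its component in bar degree `-r`.
    refine ⟨⟨fun X X' t => (T (-t.p).toNat).1 X X' t,
      fun X X' Y Y' f g t => (T (-t.p).toNat).2 X X' Y Y' f g t⟩, fun r X X' p q hr hpq b => ?_⟩
    obtain rfl : r = (-p).toNat := by clear hzero hsucc; lia
    rfl
  refine ⟨τ, ext_app fun X X' p q hpq b => ?_, hτ⟩
  have hq : (p + l) + 1 = q := by clear hzero hsucc hτ; lia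
  rw [app_diff h τ X X' rfl hq rfl hpq b, sub_eq_iff_eq_add]
  obtain hp | rfl | hp := lt_trichotomy 0 p
  · rw [Bar.eq_zero_of_pos hp b]
    simp
  · rw [Bar.eq_zero_of_pos (by simp) ((Bar k A).d _ _ rfl b), hτ 0 _ _ _ _ (by simp), map_zero,
      smul_zero, add_zero]
    exact hzero X X' _ q rfl hq b
  · obtain ⟨r, hr⟩ : ∃ r : ℕ, -(r : ℤ) = p + 1 :=
      ⟨(-(p + 1)).toNat, by clear hzero hsucc hτ; lia⟩
    have hr' : -((r + 1 : ℕ) : ℤ) = p := by clear hzero hsucc hτ; lia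
    rw [hτ r X X' _ q hr, hτ (r + 1) X X' _ _ hr']
    exact hsucc r X X' _ _ _ q hr rfl rfl hq b

/-- If the cohomology of `N` vanishes in negative degrees, a closed bimodule map `σ : Bar(A) → N` of
degree `m` which vanishes on `Bar^{-r}` for `r < m` and takes values in coboundaries for `r = m` is
the differential of a bimodule map of degree `m - 1` which vanishes on `Bar^{-r}` for `r < m`. -/
theorem exists_diff_eq (hA : ∀ X Y : A, Module.Projective k (X ⟶ Y))
    (hN : ∀ (X X' : A) (n p q : ℤ) (hn : n + 1 = p) (hp : p + 1 = q) (b : N.obj X X' p), p < 0 →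
      N.d p q hp b = 0 → ∃ c, N.d n p hn c = b)
    {l m : ℤ} (h : l + 1 = m) (σ : BimoduleHom (Bar k A) N m) (hσ : IsClosed σ)
    (hlt : ∀ (X X' : A) (p q : ℤ) (hpq : p + m = q) (b : (Bar k A).obj X X' p), -m < p →
      app σ X X' p q hpq b = 0)
    (heq : ∀ (X X' : A) (p n q : ℤ) (hpq : p + m = q) (hn : n + 1 = q)
      (b : (Bar k A).obj X X' p), p = -m → ∃ c, N.d n q hn c = app σ X X' p q hpq b) :
    ∃ τ : BimoduleHom (Bar k A) N l, diff l m h τ = σ ∧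
      ∀ (X X' : A) (p q : ℤ) (hpq : p + l = q) (b : (Bar k A).obj X X' p), -m < p →
        app τ X X' p q hpq b = 0 := by
  -- In the top degree `0` there is no earlier component, and `σ` takes cocycle values because
  -- `Bar^1 = 0`.
  obtain ⟨τ₀, hτ₀, hτ₀'⟩ := exists_primitive hA hN h σ 0 (fun X X' => hlt X X' 0)
    (fun X X' => heq X X' 0) (fun X X' q q' hpq hq b _ => by
      rw [hσ.app_d X X' (show (0 : ℤ) + 1 = 1 from rfl) hq hpq (by lia) b,
        Bar.eq_zero_of_pos zero_lt_one ((Bar k A).d 0 1 _ b), map_zero, smul_zero])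
  have succ (r : ℕ) (τ) (hτ : IsPartialPrimitive h σ τ (-(r : ℤ))) :=
    hτ.exists_next hA hN h σ hσ hlt heq τ (-((r + 1 : ℕ) : ℤ)) (-(r : ℤ)) (by push_cast; lia)
  -- `next` is defined on all bimodule maps, with its specification only on partial primitives. It
  -- can thus be iterated first and the invariant proved afterwards.
  choose! next hnext hnext' using succ
  let T (r : ℕ) : BimoduleHom (Bar k A) N l := Nat.rec τ₀ next r
  have hT (r : ℕ) : IsPartialPrimitive h σ (T r) (-(r : ℤ)) := by
    induction r with
    | zero => exact ⟨fun X X' p' q q' hp hpq hq b => hτ₀ X X' q q' hpq hq _, hτ₀'⟩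
    | succ r ih => exact hnext r _ ih
  have hsucc (r : ℕ) (X X' : A) (p p' q q' : ℤ) (hr : -(r : ℤ) = p') (hp : p + 1 = p')
      (hpq : p + l = q) (hq : q + 1 = q') (hpm : p + m = q') (hpl : p' + l = q')
      (b : (Bar k A).obj X X' p) :
      N.d q q' hq (app (T (r + 1)) X X' p q hpq b) = app σ X X' p q' hpm b +
        l.negOnePow • app (T r) X X' p' q' hpl ((Bar k A).d p p' hp b) := by
    subst hr
    obtain rfl : p = -((r + 1 : ℕ) : ℤ) := by
      push_cast
      linarith
    exact hnext' r _ (hT r) X X' q q' hpq hq b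
  obtain ⟨τ, hτ, hτ'⟩ := exists_diff_eq_of_sequence h σ T hτ₀
    (fun r X X' p p' q q' hr hp hpq hq b => hsucc r X X' p p' q q' hr hp hpq hq _ _ b)
  refine ⟨τ, hτ, fun X X' p q hpq b hp => ?_⟩
  obtain hp' | hp' := lt_or_ge 0 p
  · rw [Bar.eq_zero_of_pos hp' b, map_zero]
  · obtain ⟨r, rfl⟩ : ∃ r : ℕ, -(r : ℤ) = p := ⟨(-p).toNat, by
      rw [Int.toNat_of_nonneg (by simpa using hp'), neg_neg]⟩
    rw [hτ' r X X' _ q rfl]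
    exact (hT r).eq_zero X X' q hpq b hp

end BimoduleHom

end Bar

/-! ### Degree zero maps and their values on `[id, id]`. -/

section Bar

variable {k : Type w} [CommRing k] {A : Type u} [Category.{v} A] [Preadditive A] [Linear k A]

namespace BimoduleHom

variable {N : DGBimodule.{w, u, v, y} k A}

/-- A closed degree `0` bimodule map which sends all `[id_X, id_X]` to coboundaries is
null-homotopic, if the cohomology of `N` vanishes in negative degrees. -/
lemma exists_diff_eq_of_idId (hA : ∀ X Y : A, Module.Projective k (X ⟶ Y))
    (hN : ∀ (X X' : A) (n p q : ℤ) (hn : n + 1 = p) (hp : p + 1 = q) (b : N.obj X X' p), p < 0 →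
      N.d p q hp b = 0 → ∃ c, N.d n p hn c = b)
    (σ : BimoduleHom (Bar k A) N 0) (hσ : IsClosed σ)
    (h : ∀ X : A, ∃ c, N.d (-1) 0 rfl c = app σ X X 0 0 rfl (Bar.idId k X)) :
    ∃ τ : BimoduleHom (Bar k A) N (-1), diff (-1) 0 rfl τ = σ := by
  choose c hc using h
  obtain ⟨τ, hτ, -⟩ := exists_diff_eq hA hN (show (-1 : ℤ) + 1 = 0 from rfl) σ hσ
    (fun X X' p q hpq b hp => by
      rw [Bar.eq_zero_of_pos (by simpa using hp) b, map_zero])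
    (fun X X' p n q hpq hn b hp => by
      obtain rfl : p = 0 := by simpa using hp
      obtain rfl : q = 0 := by simpa using hpq.symm
      obtain rfl : n = -1 := by lia
      clear hp
      obtain ⟨b, rfl⟩ := (Bar.equiv X X' 0 0 rfl).symm.surjective b
      -- Passing to the quotient by the coboundaries turns the existence statement into the
      -- vanishing of a linear map, which can be checked on the elements `[f, g]`.
      change _ ∈ LinearMap.range _
      suffices h : ((N.d (-1) 0 hn).range.mkQ.comp (app σ X X' 0 0 hpq)).comp
          (Bar.equiv X X' 0 0 rfl).symm.toLinearMap = 0 by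
        simpa using LinearMap.congr_fun h b
      refine BarSum.hom_ext_cons fun Y f b => ?_
      suffices h : (((N.d (-1) 0 hn).range.mkQ.comp (app σ X X' 0 0 hpq)).comp
          (Bar.equiv X X' 0 0 rfl).symm.toLinearMap).comp (BarSum.cons f) = 0 from
        LinearMap.congr_fun h b
      refine BarSum.hom_ext fun t b => ?_
      cases t with
      | nil =>
        obtain ⟨g, rfl⟩ := BarTensor.single.surjective b
        have e : (Bar.equiv X X' 0 0 rfl).symm
            (BarSum.cons f (BarSum.incl .nil (BarTensor.single g))) =
            (Bar k A).act f g 0 (Bar.idId k Y) := by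
          rw [LinearEquiv.symm_apply_eq, Bar.equiv_act, Bar.equiv_idId]
          simp
        simp only [LinearMap.comp_apply, LinearEquiv.coe_coe, e, app_act, LinearMap.zero_apply]
        rw [Submodule.mkQ_apply, Submodule.Quotient.mk_eq_zero]
        exact ⟨N.act f g (-1) (c Y), by rw [N.d_act, hc]⟩)
  exact ⟨τ, hτ⟩

/-- If the cohomology of `N` vanishes in negative degrees, a family of cocycles `φ X ∈ N⁰(X, X)`
which is natural up to coboundaries extends to a closed degree `0` bimodule map. -/
lemma exists_isClosed (hA : ∀ X Y : A, Module.Projective k (X ⟶ Y))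
    (hN : ∀ (X X' : A) (n p q : ℤ) (hn : n + 1 = p) (hp : p + 1 = q) (b : N.obj X X' p), p < 0 →
      N.d p q hp b = 0 → ∃ c, N.d n p hn c = b)
    (φ : ∀ X : A, N.obj X X 0) (hφ : ∀ X, N.d 0 1 rfl (φ X) = 0)
    (hφ' : ∀ {X Y : A} (f : X ⟶ Y), ∃ c, N.d (-1) 0 rfl c =
      N.act f (𝟙 X) 0 (φ X) - N.act (𝟙 Y) f 0 (φ Y)) :
    ∃ τ : BimoduleHom (Bar k A) N 0, IsClosed τ ∧
      ∀ X, app τ X X 0 0 rfl (Bar.idId k X) = φ X := by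
  let β (X₀ X' : A) : ∀ t : ObjTuple A 0, BarTensor k X' X₀ t →ₗ[k] N.obj X₀ X' 0
    | .nil => (N.ractHom X' 0 (φ X₀)).comp BarTensor.single.symm.toLinearMap
  have hβ (X₀ X' Y' : A) (g : Y' ⟶ X') (t : ObjTuple A 0) (b : BarTensor k X' X₀ t) :
      β X₀ Y' t (BarTensor.ract g t b) = N.act (𝟙 X₀) g 0 (β X₀ X' t b) := by
    cases t with
    | nil =>
      obtain ⟨b, rfl⟩ := BarTensor.single.surjective b
      simp [β, N.act_act_id]
  let τ₀ : BimoduleHom (Bar k A) N 0 := single 0 0 rfl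
    (fun X X' => (BarSum.extend N β X X').comp (Bar.equiv X X' 0 0 rfl).toLinearMap)
    (fun X X' Y Y' f g b => by simp [Bar.equiv_act, BarSum.extend_act N β hβ])
  have h₀ (X X' : A) (b : BarSum k X X' 1) : app τ₀ X X' 0 0 rfl ((Bar.equiv X X' 0 0 rfl).symm b)
      = BarSum.extend N β X X' b := by
    simp [τ₀, app_single]
  have h₁ (X X' Y : A) (f : Y ⟶ X) (g : X' ⟶ Y) : BarSum.extend N β X X'
      (BarSum.incl (.cons Y .nil) (BarTensor.cons f (BarTensor.single g))) =
      N.act f g 0 (φ Y) := by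
    simp [β, N.act_id_act]
  -- The error of `τ₀` is corrected with `m = 1`: it must vanish on `Bar^0` and be coboundary-valued
  -- on `Bar^{-1}`.
  obtain ⟨τ, hτ, hτ'⟩ := exists_diff_eq hA hN (show (0 : ℤ) + 1 = 1 from rfl) (-diff 0 1 rfl τ₀)
    (by
      rw [IsClosed, diff_neg, diff_diff, neg_zero])
    (fun X X' p q hpq b hp => by
      obtain hp' | rfl : 0 < p ∨ p = 0 := by lia
      · rw [Bar.eq_zero_of_pos hp' b, map_zero]
      · obtain rfl : q = 1 := by simpa using hpq.symm
        rw [app_neg, app_diff (zero_add 1) τ₀ X X' (zero_add 1) (zero_add 1) (zero_add 0),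
          Bar.eq_zero_of_pos zero_lt_one ((Bar k A).d 0 1 (zero_add 1) b), map_zero, smul_zero, sub_zero,
          neg_eq_zero]
        obtain ⟨b, rfl⟩ := (Bar.equiv X X' 0 0 rfl).symm.surjective b
        rw [h₀]
        suffices h : (N.d 0 1 rfl).comp (BarSum.extend N β X X') = 0 from
          LinearMap.congr_fun h b
        refine BarSum.hom_ext_cons fun Y f b => ?_
        suffices h : ((N.d 0 1 rfl).comp (BarSum.extend N β X X')).comp (BarSum.cons f) = 0 from
          LinearMap.congr_fun h b
        refine BarSum.hom_ext fun t b => ?_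
        cases t with
        | nil =>
          obtain ⟨g, rfl⟩ := BarTensor.single.surjective b
          simp only [LinearMap.comp_apply, BarSum.cons_incl, h₁, N.d_act, hφ, map_zero,
            LinearMap.zero_apply])
    (fun X X' p n q hpq hn b hp => by
      obtain rfl : p = -1 := hp
      obtain rfl : q = 0 := by simpa using hpq.symm
      obtain rfl : n = -1 := by lia
      rw [app_neg, app_diff (zero_add 1) τ₀ X X' (neg_add_cancel 1) (neg_add_cancel 1) (add_zero (-1))]
      simp only [Int.negOnePow_zero, one_smul]
      -- As `τ₀` lives in bar degree `0`, only `τ₀ ∘ d` survives on `Bar^{-1}`.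
      rw [show app τ₀ X X' (-1) (-1) rfl = 0 from app_single_of_ne _ _ _ _ _ _ _ _ _ _ (by simp)]
      obtain ⟨b, rfl⟩ := (Bar.equiv X X' 1 (-1) rfl).symm.surjective b
      have e : (Bar k A).d (-1) 0 rfl ((Bar.equiv X X' 1 (-1) rfl).symm b) =
          (Bar.equiv X X' 0 0 rfl).symm (BarSum.alpha X X' 1 b) := by
        rw [LinearEquiv.eq_symm_apply, Bar.equiv_d X X' 0 (-1) 0 rfl rfl,
          LinearEquiv.apply_symm_apply]
      rw [e, h₀]
      simp only [LinearMap.zero_apply, map_zero, zero_sub, neg_neg]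
      change _ ∈ LinearMap.range _
      suffices h : ((N.d (-1) 0 hn).range.mkQ.comp (BarSum.extend N β X X')).comp
          (BarSum.alpha X X' 1) = 0 by
        simpa using LinearMap.congr_fun h b
      refine BarSum.hom_ext_cons fun Y f b => ?_
      suffices h : (((N.d (-1) 0 hn).range.mkQ.comp (BarSum.extend N β X X')).comp
          (BarSum.alpha X X' 1)).comp (BarSum.cons f) = 0 from LinearMap.congr_fun h b
      refine BarSum.hom_ext_cons fun Z g b => ?_
      suffices h : ((((N.d (-1) 0 hn).range.mkQ.comp (BarSum.extend N β X X')).comp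
          (BarSum.alpha X X' 1)).comp (BarSum.cons f)).comp (BarSum.cons g) = 0 from
        LinearMap.congr_fun h b
      refine BarSum.hom_ext fun t b => ?_
      cases t with
      | nil =>
        obtain ⟨c, rfl⟩ := BarTensor.single.surjective b
        obtain ⟨z, hz⟩ := hφ' g
        have hα : BarSum.alpha X X' (0 + 1) (BarSum.cons f (BarSum.cons g
            (BarSum.incl .nil (BarTensor.single c)))) =
            BarSum.incl (.cons Z .nil) (BarTensor.cons (g ≫ f) (BarTensor.single (k := k) c)) -
              BarSum.incl (.cons Y .nil) (BarTensor.cons f (BarTensor.single (c ≫ g))) := by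
          rw [BarSum.alpha_succ, BarSum.alpha_zero, BarSum.act_cons]
          simp
        change (N.d (-1) 0 hn).range.mkQ (BarSum.extend N β X X' (BarSum.alpha X X' (0 + 1) _)) = 0
        rw [hα, map_sub, h₁, h₁, Submodule.mkQ_apply, Submodule.Quotient.mk_eq_zero]
        -- `τ₀` sends the boundary of `[f, g, c]` to `f · (g · φ_Z - φ_Y · g) · c`, and `z` is a
        -- primitive of the middle factor.
        refine ⟨N.act f c (-1) z, ?_⟩
        rw [N.d_act, hz, map_sub, ← N.act_act, ← N.act_act, Category.comp_id, Category.id_comp])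
  refine ⟨τ₀ + τ, ?_, fun X => ?_⟩
  · change diff 0 1 rfl (τ₀ + τ) = 0
    rw [diff_add, hτ, add_neg_cancel]
  -- The correction vanishes here because `0 > -1`.
  · rw [app_add, hτ' X X 0 0 rfl _ (by simp), add_zero]
    refine (h₀ X X _).trans ?_
    refine (h₁ X X X (𝟙 X) (𝟙 X)).trans ?_
    rw [N.act_id]

end BimoduleHom

end Bar

/-! ### Cohomology and homotopy classes in terms of cochains, and the conclusion. -/

section AInfinity

variable {A : Type u} [Category.{v} A] {B : Type u'} [Category.{v'} B] [Preadditive B]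

lemma Unobstructed.exists_δ_eq {F G : A ⥤ Chb B} (h : Unobstructed F G) (X X' : A) (n p q : ℤ)
    (hn : n + 1 = p) (hp : p + 1 = q) (b : Cochain (F.obj X').obj (G.obj X).obj p) (hp' : p < 0)
    (hb : δ p q b = 0) : ∃ c, δ n p c = b := by
  have := h X X' p hp'
  have h₀ : CohomologyClass.mk (Cocycle.mk b q hp hb) = 0 := Subsingleton.elim _ _
  rw [CohomologyClass.mk_eq_zero_iff, mem_coboundaries_iff _ n hn] at h₀
  exact h₀

/-- A homotopy between chain maps is a cochain of degree `-1` whose differential is their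
difference. -/
lemma Kb.exists_δ_eq_of_map_eq {K L : Chb B} {φ ψ : K ⟶ L}
    (h : (Kb.quotient B).map φ = (Kb.quotient B).map ψ) :
    ∃ c, δ (-1) 0 c = Cochain.ofHom φ.hom - Cochain.ofHom ψ.hom := by
  have h' := congrArg (fun g : (Kb.quotient B).obj K ⟶ (Kb.quotient B).obj L => g.hom) h
  obtain ⟨z, hz⟩ := Cochain.equivHomotopy φ.hom ψ.hom (HomotopyCategory.homotopyOfEq _ _ h')
  exact ⟨z, eq_sub_of_add_eq hz.symm⟩

lemma Kb.quotient_map_surjective {K L : Chb B}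
    (f : (Kb.quotient B).obj K ⟶ (Kb.quotient B).obj L) :
    ∃ φ : K ⟶ L, (Kb.quotient B).map φ = f := by
  obtain ⟨φ, hφ⟩ := (HomotopyCategory.quotient B (ComplexShape.up ℤ)).map_surjective f.hom
  exact ⟨ObjectProperty.homMk φ, InducedCategory.hom_ext hφ⟩

variable (k : Type w) [CommRing k] [Preadditive A] [Linear k A] [Linear k B]

lemma homBimodule_act_id (F G : A ⥤ Chb B) [F.Additive] [F.Linear k] [G.Additive] [G.Linear k]
    {X X' Y : A} (f : X ⟶ Y) (n : ℤ) (m : Cochain (F.obj X').obj (G.obj X).obj n) :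
    (homBimodule k F G).act f (𝟙 X') n m = m.comp (Cochain.ofHom (G.map f).hom) (add_zero n) := by
  simp [homBimodule]
  rfl

lemma homBimodule_id_act (F G : A ⥤ Chb B) [F.Additive] [F.Linear k] [G.Additive] [G.Linear k]
    {X X' Y' : A} (g : Y' ⟶ X') (n : ℤ) (m : Cochain (F.obj X').obj (G.obj X).obj n) :
    (homBimodule k F G).act (𝟙 X) g n m =
      (Cochain.ofHom (F.map g).hom).comp m (zero_add n) := by
  simp [homBimodule]
  rfl

end AInfinity

theorem mainTheorem9 (k : Type w) [CommRing k]
    (A : Type u) [Category.{v} A] [Preadditive A] [Linear k A]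
    (hA : ∀ X Y : A, Module.Projective k (X ⟶ Y))
    (B : Type u') [Category.{v'} B] [Preadditive B] [Linear k B]
    (F G : A ⥤ Chb B) [F.Additive] [F.Linear k] [G.Additive] [G.Linear k]
    (hFG : Unobstructed F G) (η : H0 F ⟶ H0 G) :
    (∃ τ : AInfNatTrans k F G 0, BimoduleHom.IsClosed τ ∧ AInfNatTransExtends τ η) ∧
      ∀ τ τ' : AInfNatTrans k F G 0, BimoduleHom.IsClosed τ → AInfNatTransExtends τ η →
        BimoduleHom.IsClosed τ' → AInfNatTransExtends τ' η → BimoduleHom.Homotopic τ τ' := by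
  have hN : ∀ (X X' : A) (n p q : ℤ) (hn : n + 1 = p) (hp : p + 1 = q)
      (b : (homBimodule k F G).obj X X' p), p < 0 → (homBimodule k F G).d p q hp b = 0 →
      ∃ c, (homBimodule k F G).d n p hn c = b :=
    hFG.exists_δ_eq
  refine ⟨?_, fun τ τ' hτ hτη hτ' hτη' => ?_⟩
  · have hη (X : A) : ∃ φ : F.obj X ⟶ G.obj X, (Kb.quotient B).map φ = η.app X :=
      Kb.quotient_map_surjective (η.app X)
    -- The representatives are chosen independently, so they are natural only up to homotopy.
    choose φ hφ using hη
    obtain ⟨τ, hτ, hτφ⟩ := BimoduleHom.exists_isClosed hA hN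
      (fun X => Cochain.ofHom (φ X).hom) (fun X => δ_ofHom _) (fun {X Y} f => by
        have h : (Kb.quotient B).map (φ X ≫ G.map f) = (Kb.quotient B).map (F.map f ≫ φ Y) := by
          rw [Functor.map_comp, Functor.map_comp, hφ, hφ]
          exact (η.naturality f).symm
        obtain ⟨c, hc⟩ := Kb.exists_δ_eq_of_map_eq h
        refine ⟨c, hc.trans ?_⟩
        rw [homBimodule_act_id, homBimodule_id_act, ← Cochain.ofHom_comp, ← Cochain.ofHom_comp]
        rfl)
    exact ⟨τ, hτ, fun X => ⟨φ X, (hτφ X).symm, hφ X⟩⟩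
  · obtain ⟨h, hh⟩ := BimoduleHom.exists_diff_eq_of_idId hA hN (τ - τ')
      (by rw [BimoduleHom.IsClosed, BimoduleHom.diff_sub, hτ, hτ', sub_zero])
      (fun X => by
        obtain ⟨φ, hφ, hφη⟩ := hτη X
        obtain ⟨φ', hφ', hφη'⟩ := hτη' X
        obtain ⟨c, hc⟩ := Kb.exists_δ_eq_of_map_eq (hφη.trans hφη'.symm)
        exact ⟨c, hc.trans (by rw [BimoduleHom.app_sub, hφ, hφ']; rfl)⟩)
    -- The degree `0 - 1` in `Homotopic` reduces to `-1`.
    exact ⟨h, hh.symm⟩
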